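/- **Setting.** Let $\mathcal W\subset\mathbb R^d$ be nonempty, closed and convex, let $\|\cdot\|_w$ be a norm on $\mathbb R^d$ with dual norm $\|\cdot\|_{w,*}$, and let $\nu_w$ be a distance-generating function on $\mathcal W$ (continuous on $\mathcal W$, continuously differentiable at the points of $\mathcal W$ at which it has a subgradient) that is $1$-strongly convex with respect to $\|\cdot\|_w$, with $\max_{\mathcal W}\nu_w-\min_{\mathcal W}\nu_w\le D^2$. Let $\Delta_m=\{q\in\mathbb R^m: q\ge 0,\ \sum_i q_i=1\}$, $\nu_q(q)=\sum_{i=1}^m q_i\ln q_i$, and let $B_w$, $B_q$ be the Bregman distances $B(u,v)=\nu(u)-[\nu(v)+\langle\nabla\nu(v),u-v\rangle]$ of $\nu_w$, $\nu_q$. Let $\mathcal P_1,\dots,\mathcal P_m$ ($m\ge1$) be probability distributions and $\ell(w;z)$ a loss, differentiable in $w$, such that for every $i$ the risk $R_i(w)=\mathrm E_{z\sim\mathcal P_i}[\ell(w;z)]$ is convex on $\mathcal W$, and, for $\mathcal P_i$-almost every $z$ and all $w\in\mathcal W$, $0\le\ell(w;z)\le1$ and $\|\nabla\ell(w;z)\|_{w,*}\le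 G$. Let $n_1\ge n_2\ge\dots\ge n_m\ge1$ be integers and $p_i=n_i/n_1$. **Algorithm.** Put $w_1=\operatorname{argmin}_{w\in\mathcal W}\nu_w(w)$ and $q_1=(1/m,\dots,1/m)$. In each round $t=1,\dots,n_1$, for each $i\in\{1,\dots,m\}$ generate a Bernoulli variable $b_t^{(i)}$ with $\Pr[b_t^{(i)}=1]=p_i$ and, if $b_t^{(i)}=1$, draw a sample $z_t^{(i)}\sim\mathcal P_i$ (all draws being independent). With $\mathcal C_t=\{i: b_t^{(i)}=1\}$, let $g_{w,t}=\sum_{i\in\mathcal C_t}q_{t,i}\nabla\ell(w_t;z_t^{(i)})$ and let $g_{q,t}\in\mathbb R^m$ have $i$-th entry $\ell(w_t;z_t^{(i)})$ if $i\in\mathcal C_t$ and $0$ otherwise. Update $$w_{t+1}=\operatorname*{argmin}_{w\in\mathcal W}\{\eta_w\langle g_{w,t},w-w_t\rangle+B_w(w,w_t)\},\qquad q_{t+1}=\operatorname*{argmin}_{q\in\Delta_m}\{\eta_q\langle -g_{q,t},q-q_t\rangle+B_q(q,q_t)\},$$ with $\eta_w=D^2\sqrt{\frac{8}{5n_1(D^2G^2+\ln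 m)}}$ and $\eta_q=(\ln m)\sqrt{\frac{8}{5n_1(D^2G^2+\ln m)}}$ (the square roots being read as $0$ if $D^2G^2+\ln m=0$). The output is $\bar w=\frac1{n_1}\sum_{t=1}^{n_1}w_t$. **Theorem 5.** Let $p^*_\varphi=\min_{w\in\mathcal W}\max_{q\in\Delta_m}\sum_{i=1}^m q_ip_iR_i(w)$, let $0<\delta<1$ and $\mu(\delta)=8+2\ln\frac2\delta$. Then, with probability at least $1-\delta$, simultaneously for all $i\in\{1,\dots,m\}$, $$R_i(\bar w)-\frac{n_1}{n_i}\,p^*_\varphi\ \le\ \frac1{p_i}\,\mu(\delta)\sqrt{\frac{10(D^2G^2+\ln m)}{n_1}}\ =\ \mu(\delta)\,\frac{\sqrt{10(D^2G^2+\ln m)\,n_1}}{n_i}.$$ -/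

import Mathlib

open MeasureTheory ProbabilityTheory

noncomputable section

namespace WeightedGDRO

/-! ### Mirror descent set-up -/

section MirrorDescent

variable {E : Type*} [NormedAddCommGroup E] [NormedSpace ℝ E]

/-- The points of `W` at which `ν` (as a function on `W`) has a subgradient. -/
def subgradientDomain (W : Set E) (ν : E → ℝ) : Set E :=
  {v | v ∈ W ∧ ∃ g : E →L[ℝ] ℝ, ∀ u ∈ W, ν v + g (u - v) ≤ ν u}

/-- `ν` is a distance-generating function on `W` that is `1`-strongly convex with respect to the
norm of `E`, with gradient `dν`: it is continuous and `1`-strongly convex on `W`, and continuously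
differentiable at those points of `W` at which it has a subgradient. (The gradient need not exist
at the other points of `W`; the negative entropy on the simplex is an example.) -/
structure IsDistanceGenerating (W : Set E) (ν : E → ℝ) (dν : E → E →L[ℝ] ℝ) : Prop where
  continuousOn : ContinuousOn ν W
  strongConvexOn : StrongConvexOn W 1 ν
  hasGradient : ∀ v ∈ subgradientDomain W ν, HasFDerivWithinAt ν (dν v) W v
  continuousOn_gradient : ContinuousOn dν (subgradientDomain W ν)

/-- The Bregman distance `B(u, v) = ν(u) - [ν(v) + ⟨∇ν(v), u - v⟩]`. -/
def bregman (ν : E → ℝ) (dν : E → E →L[ℝ] ℝ) (u v : E) : ℝ :=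
  ν u - (ν v + dν v (u - v))

/-- `x ∈ argmin_{y ∈ S} f(y)`. -/
def IsArgmin (S : Set E) (f : E → ℝ) (x : E) : Prop :=
  x ∈ S ∧ ∀ y ∈ S, f x ≤ f y

end MirrorDescent

/-- The entropy function `ν_q(q) = ∑ᵢ qᵢ ln qᵢ`, with `0 ln 0 = 0`. -/
def entropy {m : ℕ} (q : Fin m → ℝ) : ℝ := ∑ i, q i * Real.log (q i)

/-- The gradient `(ln qᵢ + 1)ᵢ` of the entropy function at a positive vector. -/
def entropyGradient {m : ℕ} (q : Fin m → ℝ) : (Fin m → ℝ) →L[ℝ] ℝ :=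
  ∑ i, (Real.log (q i) + 1) • ContinuousLinearMap.proj (R := ℝ) (φ := fun _ : Fin m => ℝ) i

/-! ### Weighted group DRO -/

/-- The risk `R(w) = E_{z ∼ P}[ℓ(w; z)]`. -/
def risk {E Z : Type*} [MeasurableSpace Z] (loss : E → Z → ℝ) (P : Measure Z) (w : E) : ℝ :=
  ∫ z, loss w z ∂P

/-- The scale factor and sampling probability `pᵢ = nᵢ / n₁`; the largest budget `n₁` is `n 0`. -/
def scale {m : ℕ} [NeZero m] (n : Fin m → ℕ) (i : Fin m) : ℝ := (n i : ℝ) / (n 0 : ℝ)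

/-- The weighted objective `φ(w, q) = ∑ᵢ qᵢ pᵢ Rᵢ(w)`. -/
def weightedObjective {E Z : Type*} [MeasurableSpace Z] {m : ℕ} [NeZero m] (loss : E → Z → ℝ)
    (P : Fin m → Measure Z) (n : Fin m → ℕ) (w : E) (q : Fin m → ℝ) : ℝ :=
  ∑ i, q i * scale n i * risk loss (P i) w

/-- The optimal value of `min_{w ∈ W} max_{q ∈ Δ_m} φ(w, q)`. -/
def optimalValue {E Z : Type*} [MeasurableSpace Z] {m : ℕ} [NeZero m] (W : Set E)
    (loss : E → Z → ℝ) (P : Fin m → Measure Z) (n : Fin m → ℕ) : ℝ :=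
  ⨅ w : W, ⨆ q : stdSimplex ℝ (Fin m), weightedObjective loss P n (w : E) (q : Fin m → ℝ)

/-! ### The algorithm -/

/-- The random draws of `T` rounds: in round `t` and for each group `i`, `b t i` is a Bernoulli
variable with success probability `p i`, and, given `b t i = true`, the sample `z t i` has law
`P i`. The pairs `(b t i, z t i)` are independent over all rounds and groups. The value of `z t i`
when `b t i = false` is never looked at. -/
structure IsSampling {Ω Z : Type*} [MeasurableSpace Ω] [MeasurableSpace Z] {m : ℕ}
    (μ : Measure Ω) (P : Fin m → Measure Z) (p : Fin m → ℝ) (T : ℕ)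
    (b : Fin T → Fin m → Ω → Bool) (z : Fin T → Fin m → Ω → Z) : Prop where
  measurable_b : ∀ t i, Measurable (b t i)
  measurable_z : ∀ t i, Measurable (z t i)
  bernoulli : ∀ t i, μ {ω | b t i ω = true} = ENNReal.ofReal (p i)
  law : ∀ t i, Measure.map (z t i) (ProbabilityTheory.cond μ {ω | b t i ω = true}) = P i
  indep : iIndepFun (fun (k : Fin T × Fin m) (ω : Ω) => (b k.1 k.2 ω, z k.1 k.2 ω)) μ

section Algorithm

variable {E : Type*} [NormedAddCommGroup E] [NormedSpace ℝ E] {Z : Type*} {m : ℕ}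

/-- The stochastic gradient `g_w(w, q) = ∑_{i : bᵢ = 1} qᵢ ∇ℓ(w; zᵢ)`. -/
def gradW (dloss : E → Z → E →L[ℝ] ℝ) (b : Fin m → Bool) (z : Fin m → Z) (w : E)
    (q : Fin m → ℝ) : E →L[ℝ] ℝ :=
  ∑ i, if b i = true then q i • dloss w (z i) else 0

/-- The stochastic gradient `[g_q(w, q)]ᵢ = ℓ(w; zᵢ)` if `bᵢ = 1`, and `0` otherwise. -/
def gradQ (loss : E → Z → ℝ) (b : Fin m → Bool) (z : Fin m → Z) (w : E) : Fin m → ℝ :=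
  fun i => if b i = true then loss w (z i) else 0

/-- `w 0, w 1, …` and `q 0, q 1, …` are the iterates of stochastic mirror descent run for `T`
rounds with step sizes `ηw`, `ηq` on the draws `b`, `z`. -/
structure IsSMDRun (W : Set E) (ν : E → ℝ) (dν : E → E →L[ℝ] ℝ) (loss : E → Z → ℝ)
    (dloss : E → Z → E →L[ℝ] ℝ) (ηw ηq : ℝ) (T : ℕ) (b : Fin T → Fin m → Bool)
    (z : Fin T → Fin m → Z) (w : ℕ → E) (q : ℕ → Fin m → ℝ) : Prop where
  init_w : IsArgmin W ν (w 0)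
  init_q : q 0 = fun _ => 1 / (m : ℝ)
  step_w : ∀ t : Fin T, IsArgmin W
    (fun u => ηw * gradW dloss (b t) (z t) (w t) (q t) (u - w t) + bregman ν dν u (w t))
    (w ((t : ℕ) + 1))
  step_q : ∀ t : Fin T, IsArgmin (stdSimplex ℝ (Fin m))
    (fun r => ηq * ∑ i, (-gradQ loss (b t) (z t) (w t) i) * (r i - q t i)
      + bregman entropy entropyGradient r (q t))
    (q ((t : ℕ) + 1))

/-- The average of the first `T` iterates. -/
def average (w : ℕ → E) (T : ℕ) : E := (T : ℝ)⁻¹ • ∑ t ∈ Finset.range T, w t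

end Algorithm

/-- `η_w = D² √(8 / (5 T (D² G² + ln m)))`. -/
def stepW (D G : ℝ) (m T : ℕ) : ℝ :=
  D ^ 2 * √(8 / (5 * T * (D ^ 2 * G ^ 2 + Real.log m)))

/-- `η_q = (ln m) √(8 / (5 T (D² G² + ln m)))`. -/
def stepQ (D G : ℝ) (m T : ℕ) : ℝ :=
  Real.log m * √(8 / (5 * T * (D ^ 2 * G ^ 2 + Real.log m)))

end WeightedGDRO

end

noncomputable section

namespace WeightedGDRO

open Filter Topology

/-! ### Mirror descent with a general distance-generating function. -/

section ConvexAnalysis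

variable {E : Type*} [NormedAddCommGroup E] [NormedSpace ℝ E]

/-! Fix a comparator `u` in `W` and a group `i`. Convexity of the risks in `w` and linearity of the
weighted objective in `q` bound p_i R_i(w_t) - φ(u, q_t) by expected linear forms: the mean gradient
applied to w_t - u, plus the mean loss vector applied to e_i - q_t (`gap_le`). Replacing means by
samples and summing over rounds leaves two regrets and two noise sums (`weightedGap_le_noise`).

The regrets are deterministic. Mirror descent with step D²α costs 1/α + αT D²G²/2; the `q`-update is
exactly exponential weights, and with step α ln m it costs 1/α + αT ln m/2. With K = D²G² + ln m and
the given α, the total is at most (7/3)√(TK) (`regret_rate_le`).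

The noise sums are martingales, because the iterates of a round depend only on earlier draws, so an
exponential-moment induction gives Azuma–Hoeffding tails (`noise_tail`). No supremum over random
comparators is needed: `u` is a near-minimizer of the min-max problem fixed before the draws, and
the maximum of a linear form over the simplex is attained at one of m vertices. One event of
probability δ/2 for `u` and m events of probability δ/(2m) for the vertices suffice.

On the remaining event φ(u, q_t) is at most p*_φ plus a small slack, Jensen's inequality passes from
the iterates to their average, and division by p_i yields all groups at once. Measurability of the
iterates is not assumed: the argmin of a linear form plus `ν` is a Lipschitz function of that form
(`IsArgmin.norm_sub_le`). -/

theorem tendsto_slope_segment {W : Set E} (hW : Convex ℝ W) {f : E → ℝ} {f' : E →L[ℝ] ℝ}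
    {v u : E} (hf : HasFDerivWithinAt f f' W v) (hv : v ∈ W) (hu : u ∈ W) :
    Tendsto (fun s : ℝ => s⁻¹ * (f (v + s • (u - v)) - f v)) (𝓝[>] 0) (𝓝 (f' (u - v))) := by
  have hline : HasDerivWithinAt (fun s : ℝ => v + s • (u - v)) (u - v) (Set.Icc 0 1) 0 := by
    have h := ((hasDerivAt_id (0 : ℝ)).smul_const (u - v)).const_add v
    simpa using h.hasDerivWithinAt
  have hmaps : Set.MapsTo (fun s : ℝ => v + s • (u - v)) (Set.Icc 0 1) W :=
    fun s hs => hW.add_smul_sub_mem hv hu hs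
  have hf0 : HasFDerivWithinAt f f' W ((fun s : ℝ => v + s • (u - v)) 0) := by simpa using hf
  have h := (hf0.comp_hasDerivWithinAt 0 hline hmaps).mono_of_mem_nhdsWithin
    (Icc_mem_nhdsGT (zero_lt_one' ℝ))
  rw [hasDerivWithinAt_iff_tendsto_slope' (by simp)] at h
  refine h.congr fun s => ?_
  simp [slope]

/-- Divide the strong convexity inequality on the segment from `v` to `u` by its parameter and let
that tend to zero. -/
theorem half_sq_norm_sub_le_bregman {W : Set E} {ν : E → ℝ} {dν : E → E →L[ℝ] ℝ}
    (hν : StrongConvexOn W 1 ν) {u v : E} (hd : HasFDerivWithinAt ν (dν v) W v)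
    (hv : v ∈ W) (hu : u ∈ W) : 1 / 2 * ‖u - v‖ ^ 2 ≤ bregman ν dν u v := by
  have h1 := tendsto_slope_segment hν.1 hd hv hu
  have h2 : Tendsto (fun s : ℝ => ν u - ν v - (1 - s) * (1 / 2 * ‖u - v‖ ^ 2)) (𝓝[>] 0)
      (𝓝 (ν u - ν v - (1 - 0) * (1 / 2 * ‖u - v‖ ^ 2))) := by
    apply Tendsto.mono_left _ nhdsWithin_le_nhds
    apply Continuous.tendsto
    fun_prop
  have h3 := le_of_tendsto_of_tendsto h1 h2 (by
    filter_upwards [Ioo_mem_nhdsGT (zero_lt_one' ℝ)] with s hs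
    have hs0 : 0 < s := hs.1
    have h := hν.2 hu hv hs0.le (sub_nonneg.2 hs.2.le) (by ring)
    have he : s • u + (1 - s) • v = v + s • (u - v) := by module
    rw [he] at h
    simp only [smul_eq_mul] at h
    rw [inv_mul_le_iff₀ hs0]
    linarith)
  unfold bregman
  linarith

/-- Strong convexity at the midpoint makes `ν` there smaller than the mean of its endpoint values by
‖u - v‖²/8, and the range of `ν` caps this drop. In particular `D = 0` forces `W` to be a single
point. -/
theorem sq_norm_sub_le {W : Set E} {ν : E → ℝ} (hν : StrongConvexOn W 1 ν) {D : ℝ}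
    (hD : ∀ u ∈ W, ∀ v ∈ W, ν u - ν v ≤ D ^ 2) {u v : E} (hu : u ∈ W) (hv : v ∈ W) :
    ‖u - v‖ ^ 2 ≤ 8 * D ^ 2 := by
  have h := hν.2 hu hv (by norm_num : (0 : ℝ) ≤ 1 / 2) (by norm_num : (0 : ℝ) ≤ 1 / 2) (by norm_num)
  have hm : (1 / 2 : ℝ) • u + (1 / 2 : ℝ) • v ∈ W :=
    hν.1 hu hv (by norm_num) (by norm_num) (by norm_num)
  have h1 := hD u hu _ hm
  have h2 := hD v hv _ hm
  simp only [smul_eq_mul] at h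
  linarith

/-- Minimality says that `-ξ` is a subgradient. Hence every iterate lies where `dν` is a true
gradient. -/
theorem IsArgmin.mem_subgradientDomain {W : Set E} {ν : E → ℝ} {ξ : E →L[ℝ] ℝ} {v : E}
    (h : IsArgmin W (fun u => ξ u + ν u) v) : v ∈ subgradientDomain W ν := by
  refine ⟨h.1, -ξ, fun u hu => ?_⟩
  have := h.2 u hu
  simp only [neg_apply, map_sub] at this ⊢
  linarith

theorem IsArgmin.variational {W : Set E} {ν : E → ℝ} {dν : E → E →L[ℝ] ℝ}
    (hν : IsDistanceGenerating W ν dν) {ξ : E →L[ℝ] ℝ} {v : E}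
    (h : IsArgmin W (fun u => ξ u + ν u) v) {u : E} (hu : u ∈ W) : 0 ≤ (ξ + dν v) (u - v) := by
  have hd := ξ.hasFDerivWithinAt.add (hν.hasGradient v h.mem_subgradientDomain)
  refine ge_of_tendsto (tendsto_slope_segment hν.strongConvexOn.1 hd h.1 hu) ?_
  filter_upwards [Ioo_mem_nhdsGT (zero_lt_one' ℝ)] with s hs
  have := h.2 _ (hν.strongConvexOn.1.add_smul_sub_mem h.1 hu ⟨hs.1.le, hs.2.le⟩)
  exact mul_nonneg (inv_nonneg.2 hs.1.le) (sub_nonneg.2 this)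

/-- Test each optimality condition at the other minimizer and add: strong monotonicity of the
gradient gives ‖v₁ - v₂‖² ≤ (ξ₂ - ξ₁)(v₁ - v₂). This yields both uniqueness and Lipschitz dependence
of the minimizer. -/
theorem IsArgmin.norm_sub_le {W : Set E} {ν : E → ℝ} {dν : E → E →L[ℝ] ℝ}
    (hν : IsDistanceGenerating W ν dν) {ξ₁ ξ₂ : E →L[ℝ] ℝ} {v₁ v₂ : E}
    (h₁ : IsArgmin W (fun u => ξ₁ u + ν u) v₁) (h₂ : IsArgmin W (fun u => ξ₂ u + ν u) v₂) :
    ‖v₁ - v₂‖ ≤ ‖ξ₁ - ξ₂‖ := by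
  have a₁ := h₁.variational hν h₂.1
  have a₂ := h₂.variational hν h₁.1
  have b₁ := half_sq_norm_sub_le_bregman hν.strongConvexOn
    (hν.hasGradient _ h₁.mem_subgradientDomain) h₁.1 h₂.1
  have b₂ := half_sq_norm_sub_le_bregman hν.strongConvexOn
    (hν.hasGradient _ h₂.mem_subgradientDomain) h₂.1 h₁.1
  have c := (le_abs_self _).trans ((ξ₂ - ξ₁).le_opNorm (v₁ - v₂))
  rw [norm_sub_rev ξ₂] at c
  rw [norm_sub_rev v₂] at b₁
  simp only [bregman, add_apply, sub_apply, map_sub] at a₁ a₂ b₁ b₂ c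
  rcases (norm_nonneg (v₁ - v₂)).eq_or_lt with h0 | h0
  · rw [← h0]; exact norm_nonneg _
  · refine le_of_mul_le_mul_right ?_ h0
    linarith

/-- The mirror step only depends on the functional `η g - dν v`. -/
theorem IsArgmin.of_mirrorStep {W : Set E} {ν : E → ℝ} {dν : E → E →L[ℝ] ℝ} {η : ℝ}
    {g : E →L[ℝ] ℝ} {v v' : E}
    (h : IsArgmin W (fun u => η * g (u - v) + bregman ν dν u v) v') :
    IsArgmin W (fun u => (η • g - dν v) u + ν u) v' := by
  refine ⟨h.1, fun u hu => ?_⟩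
  have := h.2 u hu
  simp only [bregman, sub_apply, smul_apply, smul_eq_mul, map_sub] at this ⊢
  linarith

/-- The three-point identity for Bregman distances: optimality of `v'` controls the part g(v' - u),
and the half square in B(v', v) absorbs the remaining g(v - v') by Young's inequality. -/
theorem mirrorStep_le {W : Set E} {ν : E → ℝ} {dν : E → E →L[ℝ] ℝ}
    (hν : IsDistanceGenerating W ν dν) {η : ℝ} {g : E →L[ℝ] ℝ} {v v' u : E}
    (hv : v ∈ subgradientDomain W ν)
    (h : IsArgmin W (fun u => η * g (u - v) + bregman ν dν u v) v') (hu : u ∈ W) {G : ℝ}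
    (hg : ‖g‖ ≤ G) :
    η * g (v - u) ≤ bregman ν dν u v - bregman ν dν u v' + η ^ 2 * G ^ 2 / 2 := by
  have h' := h.of_mirrorStep
  have a := h'.variational hν hu
  have b := half_sq_norm_sub_le_bregman hν.strongConvexOn (hν.hasGradient _ hv) hv.1 h'.1
  have c : η * g (v - v') ≤ (η ^ 2 * G ^ 2 + ‖v' - v‖ ^ 2) / 2 := by
    have h1 : |g (v - v')| ≤ G * ‖v' - v‖ := by
      rw [norm_sub_rev v']
      exact (g.le_opNorm _).trans (by gcongr)
    have h2 : η * g (v - v') ≤ |η| * (G * ‖v' - v‖) :=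
      (le_abs_self _).trans (by rw [abs_mul]; gcongr)
    nlinarith [sq_nonneg (|η| * G - ‖v' - v‖), sq_abs η]
  simp only [bregman, add_apply, sub_apply, smul_apply, smul_eq_mul, map_sub] at a b c ⊢
  linarith

theorem mirrorDescent_regret {W : Set E} {ν : E → ℝ} {dν : E → E →L[ℝ] ℝ}
    (hν : IsDistanceGenerating W ν dν) {D : ℝ} (hD : ∀ u ∈ W, ∀ v ∈ W, ν u - ν v ≤ D ^ 2)
    {η G : ℝ} {T : ℕ} {g : ℕ → E →L[ℝ] ℝ} {w : ℕ → E} (h0 : IsArgmin W ν (w 0))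
    (hstep : ∀ t < T, IsArgmin W (fun u => η * g t (u - w t) + bregman ν dν u (w t)) (w (t + 1)))
    (hg : ∀ t < T, ‖g t‖ ≤ G) {u : E} (hu : u ∈ W) :
    η * ∑ t ∈ Finset.range T, g t (w t - u) ≤ D ^ 2 + T * (η ^ 2 * G ^ 2 / 2) := by
  have h0' : IsArgmin W (fun u => (0 : E →L[ℝ] ℝ) u + ν u) (w 0) := by simpa using h0
  have hdom : ∀ t ≤ T, w t ∈ subgradientDomain W ν := by
    intro t ht
    cases t with
    | zero => exact h0'.mem_subgradientDomain
    | succ t => exact (hstep t (by omega)).of_mirrorStep.mem_subgradientDomain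
  have key : ∀ k ≤ T, η * ∑ t ∈ Finset.range k, g t (w t - u) ≤
      bregman ν dν u (w 0) - bregman ν dν u (w k) + k * (η ^ 2 * G ^ 2 / 2) := by
    intro k
    induction k with
    | zero => simp
    | succ k ih =>
      intro hk
      have := mirrorStep_le hν (hdom k (by omega)) (hstep k hk) hu (hg k hk)
      have := ih (by omega)
      rw [Finset.sum_range_succ, mul_add]
      push_cast
      linarith
  have h1 := key T le_rfl
  have h2 := half_sq_norm_sub_le_bregman hν.strongConvexOn (hν.hasGradient _ (hdom T le_rfl))
    (hdom T le_rfl).1 hu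
  -- The first-order condition at the minimizer `w 0` makes the linear term of the Bregman distance
  -- nonnegative, so B(u, w 0) ≤ ν u - ν (w 0).
  have h3 := h0'.variational hν hu
  have h4 : bregman ν dν u (w 0) ≤ D ^ 2 := by
    have := hD u hu _ h0.1
    simp only [zero_add] at h3
    unfold bregman
    linarith
  nlinarith [sq_nonneg ‖u - w T‖]

end ConvexAnalysis

/-! ### The entropic update as exponential weights. -/

section Entropy

variable {m : ℕ}

/-- The exponentiated-gradient update of `q` in the direction `x`. -/
def expWeights (q x : Fin m → ℝ) : Fin m → ℝ :=
  fun i => q i * Real.exp (x i) / ∑ j, q j * Real.exp (x j)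

theorem sum_mul_exp_pos {q : Fin m → ℝ} (hq : q ∈ stdSimplex ℝ (Fin m)) (hpos : ∀ i, 0 < q i)
    (x : Fin m → ℝ) : 0 < ∑ j, q j * Real.exp (x j) := by
  refine Finset.sum_pos (fun i _ => mul_pos (hpos i) (Real.exp_pos _)) ?_
  by_contra h
  have := hq.2
  simp [Finset.not_nonempty_iff_eq_empty.1 h] at this

theorem sub_le_mul_log_div {r s : ℝ} (hr : 0 ≤ r) (hs : 0 < s) :
    r - s ≤ r * (Real.log r - Real.log s) ∧
      (r * (Real.log r - Real.log s) ≤ r - s → r = s) := by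
  rcases hr.eq_or_lt with rfl | hr
  · simp only [zero_sub, zero_mul]
    exact ⟨by linarith, fun h => by linarith⟩
  · have h : Real.log r - Real.log s = -Real.log (s / r) := by
      rw [Real.log_div hs.ne' hr.ne']; ring
    have e : r * (s / r - 1) = s - r := by field_simp
    rw [h]
    constructor
    · nlinarith [Real.log_le_sub_one_of_pos (div_pos hs hr)]
    · intro h'
      by_contra hne
      have := Real.log_lt_sub_one_of_pos (div_pos hs hr) (by
        rw [ne_eq, div_eq_one_iff_eq hr.ne']; exact fun h => hne h.symm)
      nlinarith

/-- Up to a constant the objective is the Kullback–Leibler divergence from `r` to the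
exponential-weights vector, which vanishes only there. Working with this closed form keeps the
weights positive and avoids the boundary of the simplex, where the entropy has no gradient. -/
theorem eq_expWeights_of_isArgmin {η : ℝ} {g q q' : Fin m → ℝ} (hq : q ∈ stdSimplex ℝ (Fin m))
    (hpos : ∀ i, 0 < q i)
    (h : IsArgmin (stdSimplex ℝ (Fin m)) (fun r => η * ∑ i, (-g i) * (r i - q i)
      + bregman entropy entropyGradient r q) q') :
    q' = expWeights q fun i => η * g i := by
  have hZ := sum_mul_exp_pos hq hpos fun i => η * g i
  set Z := ∑ j, q j * Real.exp (η * g j) with hZdef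
  set s : Fin m → ℝ := expWeights q fun i => η * g i with hs
  have hspos : ∀ i, 0 < s i := fun i => div_pos (mul_pos (hpos i) (Real.exp_pos _)) hZ
  have hslog : ∀ i, Real.log (s i) = Real.log (q i) + η * g i - Real.log Z := by
    intro i
    rw [hs, expWeights, Real.log_div (mul_pos (hpos i) (Real.exp_pos _)).ne' hZ.ne',
      Real.log_mul (hpos i).ne' (Real.exp_pos _).ne', Real.log_exp]
  have hssum : ∑ i, s i = 1 := by
    simp only [hs, expWeights]
    rw [← Finset.sum_div, div_self hZ.ne']
  have hobj : ∀ r ∈ stdSimplex ℝ (Fin m), η * ∑ i, (-g i) * (r i - q i)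
      + bregman entropy entropyGradient r q =
        ∑ i, r i * (Real.log (r i) - Real.log (s i)) - Real.log Z + η * ∑ i, g i * q i := by
    intro r hr
    have e : ∀ i, r i * (Real.log (r i) - Real.log (s i)) =
        (η * ((-g i) * (r i - q i)) + (r i * Real.log (r i)
          - (q i * Real.log (q i) + (Real.log (q i) + 1) * (r i - q i)))) - η * (g i * q i)
          + (r i - q i) + r i * Real.log Z := by
      intro i; rw [hslog]; ring
    have e' : ∑ i, r i * (Real.log (r i) - Real.log (s i)) =
        η * ∑ i, (-g i) * (r i - q i) + (∑ i, r i * Real.log (r i)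
          - (∑ i, q i * Real.log (q i) + ∑ i, (Real.log (q i) + 1) * (r i - q i)))
          - η * ∑ i, g i * q i + (∑ i, r i - ∑ i, q i) + (∑ i, r i) * Real.log Z := by
      simp only [Finset.mul_sum, Finset.sum_mul, ← Finset.sum_add_distrib,
        ← Finset.sum_sub_distrib]
      exact Finset.sum_congr rfl fun i _ => e i
    rw [e', hr.2, hq.2]
    simp only [bregman, entropy, entropyGradient, sum_apply, smul_apply,
      ContinuousLinearMap.proj_apply, Pi.sub_apply, smul_eq_mul]
    ring
  have hmin := h.2 s ⟨fun i => (hspos i).le, hssum⟩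
  simp only [] at hmin
  rw [hobj _ h.1, hobj s ⟨fun i => (hspos i).le, hssum⟩] at hmin
  simp only [sub_self, mul_zero, Finset.sum_const_zero] at hmin
  -- Both vectors sum to one, so subtracting `q' i - s i` leaves the divergence unchanged while
  -- making each summand nonnegative, hence zero.
  have hle : ∀ i ∈ Finset.univ, 0 ≤ q' i * (Real.log (q' i) - Real.log (s i)) - (q' i - s i) :=
    fun i _ => sub_nonneg.2 (sub_le_mul_log_div (h.1.1 i) (hspos i)).1
  have hsum : ∑ i, (q' i * (Real.log (q' i) - Real.log (s i)) - (q' i - s i)) = 0 := by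
    refine le_antisymm ?_ (Finset.sum_nonneg hle)
    rw [Finset.sum_sub_distrib, Finset.sum_sub_distrib, hssum, h.1.2]
    linarith
  rw [Finset.sum_eq_zero_iff_of_nonneg hle] at hsum
  funext i
  exact (sub_le_mul_log_div (h.1.1 i) (hspos i)).2 (by linarith [hsum i (Finset.mem_univ i)])

theorem expWeights_mem {q : Fin m → ℝ} (hq : q ∈ stdSimplex ℝ (Fin m)) (hpos : ∀ i, 0 < q i)
    (x : Fin m → ℝ) :
    expWeights q x ∈ stdSimplex ℝ (Fin m) ∧ ∀ i, 0 < expWeights q x i := by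
  have hZ := sum_mul_exp_pos hq hpos x
  have h : ∀ i, 0 < expWeights q x i := fun i => div_pos (mul_pos (hpos i) (Real.exp_pos _)) hZ
  refine ⟨⟨fun i => (h i).le, ?_⟩, h⟩
  simp only [expWeights]
  rw [← Finset.sum_div, div_self hZ.ne']

theorem exp_le_cosh_add_mul_sinh {x : ℝ} (y : ℝ) (hx : |x| ≤ 1) :
    Real.exp (y * x) ≤ Real.cosh y + x * Real.sinh y := by
  obtain ⟨h1, h2⟩ := abs_le.1 hx
  have h := convexOn_exp.2 (Set.mem_univ y) (Set.mem_univ (-y))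
    (by linarith : 0 ≤ (1 + x) / 2) (by linarith : 0 ≤ (1 - x) / 2) (by ring)
  simp only [smul_eq_mul] at h
  have e : y * x = (1 + x) / 2 * y + (1 - x) / 2 * -y := by ring
  rw [Real.cosh_eq, Real.sinh_eq, e]
  linarith

/-- Centre `g` at its mean, replace exp by its chord over `[-η, η]`, so that the linear part
averages out, and use cosh η ≤ exp(η²/2). -/
theorem log_sum_mul_exp_le {q g : Fin m → ℝ} (hq : q ∈ stdSimplex ℝ (Fin m)) (hpos : ∀ i, 0 < q i)
    (hg : ∀ i, 0 ≤ g i ∧ g i ≤ 1) (η : ℝ) :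
    Real.log (∑ i, q i * Real.exp (η * g i)) ≤ η * ∑ i, q i * g i + η ^ 2 / 2 := by
  set a := ∑ i, q i * g i with ha
  have ha0 : 0 ≤ a := Finset.sum_nonneg fun i _ => mul_nonneg (hq.1 i) (hg i).1
  have ha1 : a ≤ 1 := by
    rw [← hq.2]
    exact Finset.sum_le_sum fun i _ => mul_le_of_le_one_right (hq.1 i) (hg i).2
  have h1 : ∑ i, q i * Real.exp (η * (g i - a)) ≤ Real.cosh η := by
    calc _ ≤ ∑ i, q i * (Real.cosh η + (g i - a) * Real.sinh η) := by
          refine Finset.sum_le_sum fun i _ => mul_le_mul_of_nonneg_left ?_ (hq.1 i)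
          refine exp_le_cosh_add_mul_sinh η (abs_le.2 ?_)
          constructor <;> linarith [(hg i).1, (hg i).2]
      _ = (∑ i, q i) * Real.cosh η + (∑ i, q i * g i - (∑ i, q i) * a) * Real.sinh η := by
          rw [Finset.sum_mul, Finset.sum_mul, ← Finset.sum_sub_distrib, Finset.sum_mul,
            ← Finset.sum_add_distrib]
          exact Finset.sum_congr rfl fun i _ => by ring
      _ = Real.cosh η := by rw [hq.2, ← ha]; ring
  rw [Real.log_le_iff_le_exp (sum_mul_exp_pos hq hpos _)]
  calc ∑ i, q i * Real.exp (η * g i) = Real.exp (η * a) * ∑ i, q i * Real.exp (η * (g i - a)) := by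
        rw [Finset.mul_sum]
        refine Finset.sum_congr rfl fun i _ => ?_
        rw [mul_left_comm, ← Real.exp_add]
        ring_nf
    _ ≤ Real.exp (η * a) * Real.exp (η ^ 2 / 2) := by
        gcongr
        exact h1.trans (Real.cosh_le_exp_half_sq η)
    _ = _ := by rw [← Real.exp_add]

/-- The potential is the logarithm of the `i`-th weight: it starts at `-log m`, never exceeds zero,
and each round changes it by `η * g t i` minus the log-normalizer. -/
theorem expWeights_regret {η : ℝ} {T : ℕ} {g q : ℕ → Fin m → ℝ}
    (h0 : q 0 = fun _ => 1 / (m : ℝ)) (hq : ∀ t ≤ T, q t ∈ stdSimplex ℝ (Fin m))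
    (hpos : ∀ t ≤ T, ∀ i, 0 < q t i)
    (hstep : ∀ t < T, q (t + 1) = expWeights (q t) fun i => η * g t i)
    (hg : ∀ t < T, ∀ i, 0 ≤ g t i ∧ g t i ≤ 1) (i : Fin m) :
    η * ∑ t ∈ Finset.range T, (g t i - ∑ j, q t j * g t j) ≤ Real.log m + T * (η ^ 2 / 2) := by
  have key : ∀ k ≤ T, η * ∑ t ∈ Finset.range k, (g t i - ∑ j, q t j * g t j) ≤
      Real.log (q k i) - Real.log (q 0 i) + k * (η ^ 2 / 2) := by
    intro k
    induction k with
    | zero => simp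
    | succ k ih =>
      intro hk
      have h1 := ih (by omega)
      have h2 := log_sum_mul_exp_le (hq k (by omega)) (hpos k (by omega)) (hg k hk) η
      have hZ := sum_mul_exp_pos (hq k (by omega)) (hpos k (by omega)) fun i => η * g k i
      have h3 : Real.log (q (k + 1) i) = Real.log (q k i) + η * g k i
          - Real.log (∑ j, q k j * Real.exp (η * g k j)) := by
        rw [hstep k hk, expWeights, Real.log_div
          (mul_pos (hpos k (by omega) i) (Real.exp_pos _)).ne' hZ.ne',
          Real.log_mul (hpos k (by omega) i).ne' (Real.exp_pos _).ne', Real.log_exp]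
      rw [Finset.sum_range_succ, mul_add]
      push_cast
      linarith
  have h1 := key T le_rfl
  have h2 : Real.log (q T i) ≤ 0 :=
    Real.log_nonpos (hpos T le_rfl i).le
      ((Finset.single_le_sum (fun j _ => (hq T le_rfl).1 j) (Finset.mem_univ i)).trans
        (hq T le_rfl).2.le)
  have h3 : Real.log (q 0 i) = -Real.log m := by rw [h0]; simp
  linarith

end Entropy

/-! ### Azuma–Hoeffding for adaptively chosen functions of fresh draws. -/

section Concentration

open scoped ENNReal

variable {Ω : Type*} [mΩ : MeasurableSpace Ω] {μ : Measure Ω} [IsProbabilityMeasure μ]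

/-- Hoeffding's lemma for the deviation of the mean from a variable with values in `[-c, c]`. -/
theorem lintegral_exp_mean_sub_le {β : Type*} [MeasurableSpace β] {ρ : Measure β}
    [IsProbabilityMeasure ρ] {f : β → ℝ} (hf : Measurable f) {c : ℝ} (hc : 0 ≤ c)
    (hb : ∀ᵐ x ∂ρ, |f x| ≤ c) (s : ℝ) :
    ∫⁻ x, ENNReal.ofReal (Real.exp (s * (∫ y, f y ∂ρ - f x))) ∂ρ
      ≤ ENNReal.ofReal (Real.exp (s ^ 2 * c ^ 2 / 2)) := by
  have h := hasSubgaussianMGF_of_mem_Icc (a := -c) (b := c) hf.aemeasurable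
    (by filter_upwards [hb] with x hx using abs_le.1 hx)
  have h1 := h.integrable_exp_mul (-s)
  have h2 := h.mgf_le (-s)
  have e : ∀ x, s * (∫ y, f y ∂ρ - f x) = -s * (f x - ∫ y, f y ∂ρ) := fun x => by ring
  simp_rw [e]
  rw [← ofReal_integral_eq_lintegral_ofReal h1 (Eventually.of_forall fun x => (Real.exp_pos _).le)]
  refine ENNReal.ofReal_le_ofReal (h2.trans (Real.exp_le_exp.2 (le_of_eq ?_)))
  simp only [NNReal.coe_pow, NNReal.coe_div, coe_nnnorm, NNReal.coe_ofNat, Real.norm_eq_abs,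
    sub_neg_eq_add]
  rw [abs_of_nonneg (by linarith)]
  ring

theorem measurable_integral_comp {α β : Type*} [MeasurableSpace α] [MeasurableSpace β]
    {X : Ω → β} (hX : Measurable X) {Y : α → β → ℝ} (hY : Measurable (Function.uncurry Y)) :
    Measurable fun h => ∫ ω, Y h (X ω) ∂μ := by
  refine StronglyMeasurable.measurable ?_
  refine StronglyMeasurable.integral_prod_right (f := fun h ω => Y h (X ω)) ?_
  exact (hY.comp (measurable_fst.prodMk (hX.comp measurable_snd))).stronglyMeasurable

theorem measurable_sum_mean_sub {α β : Type*} [MeasurableSpace α] [MeasurableSpace β]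
    (ℱ : ℕ → MeasurableSpace Ω) (hℱ : Monotone ℱ) (hle : ∀ t, ℱ t ≤ mΩ) {T : ℕ}
    {H : ℕ → Ω → α} {X : ℕ → Ω → β} (hH : ∀ t < T, Measurable[ℱ t] (H t))
    (hX : ∀ t < T, Measurable[ℱ (t + 1)] (X t))
    {Y : α → β → ℝ} (hY : Measurable (Function.uncurry Y)) {k : ℕ} (hk : k ≤ T) :
    Measurable[ℱ k] fun ω => ∑ t ∈ Finset.range k,
      (∫ ω', Y (H t ω) (X t ω') ∂μ - Y (H t ω) (X t ω)) := by
  refine Finset.measurable_sum _ fun t ht => ?_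
  have htk : t < k := Finset.mem_range.1 ht
  have h1 : Measurable[ℱ k] (H t) := (hH t (by omega)).mono (hℱ htk.le) le_rfl
  have h2 : Measurable[ℱ k] (X t) := (hX t (by omega)).mono (hℱ htk) le_rfl
  have h3 : Measurable (X t) := h2.mono (hle k) le_rfl
  exact ((measurable_integral_comp h3 hY).comp h1).sub (hY.comp (h1.prodMk h2))

/-- Induction on the number of rounds: the newest draw is integrated out first, with the past
frozen, and Hoeffding's lemma contributes one factor. Lower integrals remove any integrability
question. -/
theorem lintegral_exp_sum_le {α β : Type*} [MeasurableSpace α] [MeasurableSpace β]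
    (ℱ : ℕ → MeasurableSpace Ω) (hℱ : Monotone ℱ) (hle : ∀ t, ℱ t ≤ mΩ) {T : ℕ}
    {H : ℕ → Ω → α} {X : ℕ → Ω → β} (hH : ∀ t < T, Measurable[ℱ t] (H t))
    (hX : ∀ t < T, Measurable[ℱ (t + 1)] (X t))
    (hind : ∀ t < T, Indep (ℱ t) (MeasurableSpace.comap (X t) inferInstance) μ)
    {Y : α → β → ℝ} (hY : Measurable (Function.uncurry Y)) {c : ℝ} (hc : 0 ≤ c)
    (hb : ∀ t < T, ∀ h, ∀ᵐ ω ∂μ, |Y h (X t ω)| ≤ c) (s : ℝ) {k : ℕ} (hk : k ≤ T) :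
    ∫⁻ ω, ENNReal.ofReal (Real.exp (s * ∑ t ∈ Finset.range k,
        (∫ ω', Y (H t ω) (X t ω') ∂μ - Y (H t ω) (X t ω)))) ∂μ
      ≤ ENNReal.ofReal (Real.exp (k * (s ^ 2 * c ^ 2 / 2))) := by
  have hXm : ∀ t < T, Measurable (X t) := fun t ht => (hX t ht).mono (hle _) le_rfl
  induction k with
  | zero => simp
  | succ k ih =>
    have hkT : k < T := hk
    set S : Ω → ℝ := fun ω => ∑ t ∈ Finset.range k,
      (∫ ω', Y (H t ω) (X t ω') ∂μ - Y (H t ω) (X t ω)) with hSdef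
    have hSm : Measurable[ℱ k] S := measurable_sum_mean_sub ℱ hℱ hle hH hX hY hkT.le
    have hpair : Measurable[ℱ k] fun ω => (S ω, H k ω) := hSm.prodMk (hH k hkT)
    have hpairm : Measurable fun ω => (S ω, H k ω) := hpair.mono (hle k) le_rfl
    -- The past sum and the current state are functions of the history, so their joint law with the
    -- new draw is a product and Tonelli applies.
    have hindep : (fun ω => (S ω, H k ω)) ⟂ᵢ[μ] X k := by
      rw [IndepFun_iff_Indep]
      exact indep_of_indep_of_le_left (hind k hkT) hpair.comap_le
    have hprod := (indepFun_iff_map_prod_eq_prod_map_map hpairm.aemeasurable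
      (hXm k hkT).aemeasurable).1 hindep
    let F : (ℝ × α) × β → ℝ≥0∞ := fun x =>
      ENNReal.ofReal (Real.exp (s * (x.1.1 + (∫ ω', Y x.1.2 (X k ω') ∂μ - Y x.1.2 x.2))))
    have hF : Measurable F := by
      refine ENNReal.measurable_ofReal.comp (Real.measurable_exp.comp (Measurable.const_mul ?_ s))
      refine (measurable_fst.comp measurable_fst).add (Measurable.sub ?_ ?_)
      · exact (measurable_integral_comp (hXm k hkT) hY).comp (measurable_snd.comp measurable_fst)
      · exact hY.comp ((measurable_snd.comp measurable_fst).prodMk measurable_snd)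
    have hstep : ∀ h, ∫⁻ ω', ENNReal.ofReal (Real.exp (s * (∫ ω'', Y h (X k ω'') ∂μ - Y h (X k ω'))))
        ∂μ ≤ ENNReal.ofReal (Real.exp (s ^ 2 * c ^ 2 / 2)) := fun h =>
      lintegral_exp_mean_sub_le (f := fun ω => Y h (X k ω))
        (hY.comp (measurable_const.prodMk (hXm k hkT))) hc (hb k hkT h) s
    calc _ = ∫⁻ ω, F ((S ω, H k ω), X k ω) ∂μ := by
          refine lintegral_congr fun ω => ?_
          simp only [F, hSdef, Finset.sum_range_succ]
      _ = ∫⁻ x, F x ∂(μ.map (fun ω => (S ω, H k ω))).prod (μ.map (X k)) := by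
          rw [← hprod, lintegral_map hF (hpairm.prodMk (hXm k hkT))]
      _ = ∫⁻ ω, ∫⁻ ω', F ((S ω, H k ω), X k ω') ∂μ ∂μ := by
          rw [lintegral_prod _ hF.aemeasurable, lintegral_map hF.lintegral_prod_right' hpairm]
          refine lintegral_congr fun ω => ?_
          exact lintegral_map (f := fun y => F ((S ω, H k ω), y)) (hF.comp measurable_prodMk_left)
            (hXm k hkT)
      _ ≤ ∫⁻ ω, ENNReal.ofReal (Real.exp (s * S ω))
            * ENNReal.ofReal (Real.exp (s ^ 2 * c ^ 2 / 2)) ∂μ := by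
          refine lintegral_mono fun ω => ?_
          calc ∫⁻ ω', F ((S ω, H k ω), X k ω') ∂μ
              = ∫⁻ ω', ENNReal.ofReal (Real.exp (s * S ω)) * ENNReal.ofReal (Real.exp
                  (s * (∫ ω'', Y (H k ω) (X k ω'') ∂μ - Y (H k ω) (X k ω')))) ∂μ := by
                refine lintegral_congr fun ω' => ?_
                simp only [F]
                rw [mul_add, Real.exp_add, ENNReal.ofReal_mul (Real.exp_pos _).le]
            _ = ENNReal.ofReal (Real.exp (s * S ω)) * ∫⁻ ω', ENNReal.ofReal (Real.exp
                  (s * (∫ ω'', Y (H k ω) (X k ω'') ∂μ - Y (H k ω) (X k ω')))) ∂μ :=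
                lintegral_const_mul' _ _ ENNReal.ofReal_ne_top
            _ ≤ _ := by gcongr; exact hstep _
      _ = (∫⁻ ω, ENNReal.ofReal (Real.exp (s * S ω)) ∂μ)
            * ENNReal.ofReal (Real.exp (s ^ 2 * c ^ 2 / 2)) :=
          lintegral_mul_const' _ _ ENNReal.ofReal_ne_top
      _ ≤ ENNReal.ofReal (Real.exp (k * (s ^ 2 * c ^ 2 / 2)))
            * ENNReal.ofReal (Real.exp (s ^ 2 * c ^ 2 / 2)) := by gcongr; exact ih hkT.le
      _ = _ := by
          rw [← ENNReal.ofReal_mul (Real.exp_pos _).le, ← Real.exp_add]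
          push_cast
          ring_nf

/-- An Azuma–Hoeffding tail bound for the deviations of an adaptively chosen function of fresh
independent draws from their means. -/
theorem measureReal_sum_mean_sub_ge_le {α β : Type*} [MeasurableSpace α] [MeasurableSpace β]
    (ℱ : ℕ → MeasurableSpace Ω) (hℱ : Monotone ℱ) (hle : ∀ t, ℱ t ≤ mΩ) {T : ℕ}
    {H : ℕ → Ω → α} {X : ℕ → Ω → β} (hH : ∀ t < T, Measurable[ℱ t] (H t))
    (hX : ∀ t < T, Measurable[ℱ (t + 1)] (X t))
    (hind : ∀ t < T, Indep (ℱ t) (MeasurableSpace.comap (X t) inferInstance) μ)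
    {Y : α → β → ℝ} (hY : Measurable (Function.uncurry Y)) {c : ℝ} (hc : 0 ≤ c)
    (hb : ∀ t < T, ∀ h, ∀ᵐ ω ∂μ, |Y h (X t ω)| ≤ c) {s : ℝ} (hs : 0 < s) (l : ℝ) :
    μ.real {ω | s * T * c ^ 2 / 2 + l / s ≤ ∑ t ∈ Finset.range T,
        (∫ ω', Y (H t ω) (X t ω') ∂μ - Y (H t ω) (X t ω))} ≤ Real.exp (-l) := by
  have h := lintegral_exp_sum_le ℱ hℱ hle hH hX hind hY hc hb s le_rfl
  set S : Ω → ℝ := fun ω => ∑ t ∈ Finset.range T,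
    (∫ ω', Y (H t ω) (X t ω') ∂μ - Y (H t ω) (X t ω)) with hS
  set A := s * T * c ^ 2 / 2 + l / s with hA
  have hsA : s * A = T * (s ^ 2 * c ^ 2 / 2) + l := by rw [hA]; field_simp
  have hSm : Measurable S :=
    (measurable_sum_mean_sub ℱ hℱ hle hH hX hY le_rfl).mono (hle T) le_rfl
  -- Markov's inequality for exp(s S); the level `A` is set so that `s * A` exceeds the exponent of
  -- the moment bound by exactly `l`.
  have hmk := mul_meas_ge_le_lintegral (μ := μ)
    (ENNReal.measurable_ofReal.comp (Real.measurable_exp.comp (hSm.const_mul s)))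
    (ENNReal.ofReal (Real.exp (s * A)))
  have hsub : {ω | A ≤ S ω} ⊆ {ω | ENNReal.ofReal (Real.exp (s * A))
      ≤ (ENNReal.ofReal ∘ Real.exp ∘ fun ω => s * S ω) ω} := fun ω hω =>
    ENNReal.ofReal_le_ofReal (Real.exp_le_exp.2 (mul_le_mul_of_nonneg_left hω hs.le))
  have h1 := ((mul_le_mul_right (measure_mono (μ := μ) hsub) _).trans hmk).trans h
  have h2 := ENNReal.toReal_mono ENNReal.ofReal_ne_top h1
  rw [ENNReal.toReal_mul, ENNReal.toReal_ofReal (Real.exp_pos _).le,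
    ENNReal.toReal_ofReal (Real.exp_pos _).le, hsA, Real.exp_add, mul_assoc] at h2
  have h3 := le_of_mul_le_mul_left (h2.trans_eq (mul_one _).symm) (Real.exp_pos _)
  rw [Real.exp_neg, ← one_div, le_div_iff₀ (Real.exp_pos _), mul_comm]
  exact h3

end Concentration

/-! ### Independence of rounds and expectations of the Bernoulli-thinned draws. -/

section Sampling

variable {Ω Z : Type*} [MeasurableSpace Z] {m T : ℕ} {b : Fin T → Fin m → Ω → Bool}
  {z : Fin T → Fin m → Ω → Z}

/-- The draws of round `t`. -/
def draw [NeZero T] (b : Fin T → Fin m → Ω → Bool) (z : Fin T → Fin m → Ω → Z) (t : ℕ) (ω : Ω) :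
    Fin m → Bool × Z :=
  fun i => (b (Fin.ofNat T t) i ω, z (Fin.ofNat T t) i ω)

/-- The σ-algebra generated by the draws of the rounds whose index lies in `S`. -/
@[reducible]
def drawSigma (b : Fin T → Fin m → Ω → Bool) (z : Fin T → Fin m → Ω → Z) (S : Set ℕ) :
    MeasurableSpace Ω :=
  ⨆ k ∈ {k : Fin T × Fin m | (k.1 : ℕ) ∈ S},
    MeasurableSpace.comap (fun ω => (b k.1 k.2 ω, z k.1 k.2 ω)) inferInstance

theorem drawSigma_mono {S S' : Set ℕ} (h : S ⊆ S') : drawSigma b z S ≤ drawSigma b z S' :=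
  biSup_mono fun _ hk => h hk

theorem measurable_draw [NeZero T] {S : Set ℕ} {t : ℕ} (ht : t < T) (hS : t ∈ S) :
    Measurable[drawSigma b z S] (draw b z t) := by
  refine @measurable_pi_iff _ _ _ (drawSigma b z S) _ _ |>.2 fun i => ?_
  have hk : (Fin.ofNat T t, i) ∈ {k : Fin T × Fin m | (k.1 : ℕ) ∈ S} := by
    simpa [Fin.ofNat, Nat.mod_eq_of_lt ht] using hS
  exact measurable_iff_comap_le.2 (le_iSup₂_of_le (Fin.ofNat T t, i) hk le_rfl)

variable [mΩ : MeasurableSpace Ω] {μ : Measure Ω} {P : Fin m → Measure Z} {p : Fin m → ℝ}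

theorem IsSampling.drawSigma_le (h : IsSampling μ P p T b z) (S : Set ℕ) :
    drawSigma b z S ≤ mΩ :=
  iSup₂_le fun k _ => ((h.measurable_b k.1 k.2).prodMk (h.measurable_z k.1 k.2)).comap_le

theorem IsSampling.indep_draw [NeZero T] (h : IsSampling μ P p T b z) {t : ℕ} (ht : t < T) :
    Indep (drawSigma b z (Set.Iio t)) (MeasurableSpace.comap (draw b z t) inferInstance) μ := by
  have hd : Disjoint {k : Fin T × Fin m | (k.1 : ℕ) ∈ Set.Iio t}
      {k : Fin T × Fin m | (k.1 : ℕ) ∈ ({t} : Set ℕ)} := by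
    rw [Set.disjoint_left]
    intro k h1 h2
    simp only [Set.mem_ofPred_eq, Set.mem_Iio, Set.mem_singleton_iff] at h1 h2
    omega
  have hi := indep_iSup_of_disjoint
    (fun k : Fin T × Fin m =>
      ((h.measurable_b k.1 k.2).prodMk (h.measurable_z k.1 k.2)).comap_le) h.indep.iIndep hd
  exact indep_of_indep_of_le_right hi (measurable_draw ht (Set.mem_singleton t)).comap_le

theorem IsSampling.measurableSet_b (h : IsSampling μ P p T b z) (t : Fin T) (i : Fin m) :
    MeasurableSet {ω | b t i ω = true} :=
  h.measurable_b t i (measurableSet_singleton true)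

/-- The law of a sample is prescribed only conditionally on its Bernoulli variable, so an almost
sure property transfers only to draws that are used. -/
theorem IsSampling.ae_of_ae [IsProbabilityMeasure μ] (h : IsSampling μ P p T b z) {i : Fin m}
    {Q : Z → Prop} (hQ : ∀ᵐ x ∂P i, Q x) (t : Fin T) :
    ∀ᵐ ω ∂μ, b t i ω = true → Q (z t i ω) := by
  rw [← h.law t i] at hQ
  have h1 := ae_of_ae_map (h.measurable_z t i).aemeasurable hQ
  rw [ProbabilityTheory.cond,
    Measure.ae_ennreal_smul_measure_iff (ENNReal.inv_ne_zero.2 (measure_ne_top _ _)),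
    ae_restrict_iff' (h.measurableSet_b t i)] at h1
  exact h1

theorem IsSampling.integrable_ite [IsProbabilityMeasure μ] (h : IsSampling μ P p T b z)
    (t : Fin T) (i : Fin m) {f : Z → ℝ} (hf : Measurable f) {c : ℝ}
    (hc : ∀ᵐ x ∂P i, |f x| ≤ c) :
    Integrable (fun ω => if b t i ω = true then f (z t i ω) else 0) μ := by
  refine Integrable.of_bound ((hf.comp (h.measurable_z t i)).ite (h.measurableSet_b t i)
    measurable_const).aestronglyMeasurable |c| ?_
  filter_upwards [h.ae_of_ae hc t] with ω hω
  split_ifs with hb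
  · exact (hω hb).trans (le_abs_self c)
  · simp

theorem IsSampling.integral_ite [IsProbabilityMeasure μ] (h : IsSampling μ P p T b z)
    (t : Fin T) (i : Fin m) (hp : 0 < p i) {f : Z → ℝ} (hf : Measurable f) :
    ∫ ω, (if b t i ω = true then f (z t i ω) else 0) ∂μ = p i * ∫ x, f x ∂P i := by
  have hs := h.measurableSet_b t i
  rw [← h.law t i, integral_map (h.measurable_z t i).aemeasurable hf.aestronglyMeasurable,
    ProbabilityTheory.cond, integral_smul_measure, h.bernoulli t i, ENNReal.toReal_inv,
    ENNReal.toReal_ofReal hp.le, smul_eq_mul, mul_inv_cancel_left₀ hp.ne', ← integral_indicator hs]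
  exact integral_congr_ae (Eventually.of_forall fun ω => by simp [Set.indicator_apply])

theorem IsSampling.integral_sum_ite [IsProbabilityMeasure μ] (h : IsSampling μ P p T b z)
    (hp : ∀ i, 0 < p i) (t : Fin T) {f : Fin m → Z → ℝ} (hf : ∀ i, Measurable (f i)) {c : Fin m → ℝ}
    (hc : ∀ i, ∀ᵐ x ∂P i, |f i x| ≤ c i) :
    ∫ ω, ∑ i, (if b t i ω = true then f i (z t i ω) else 0) ∂μ = ∑ i, p i * ∫ x, f i x ∂P i := by
  rw [integral_finsetSum _ fun i _ => h.integrable_ite t i (hf i) (hc i)]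
  exact Finset.sum_congr rfl fun i _ => h.integral_ite t i (hp i) (hf i)

end Sampling

/-! ### Measurability of the updates. -/

section Measurability

variable {E : Type*} [NormedAddCommGroup E] [NormedSpace ℝ E] [MeasurableSpace E]
  {Z : Type*} [MeasurableSpace Z] {m : ℕ}

/-- By uniqueness `v` factors through a minimizer map defined on the functionals that have a
minimizer; that map is 1-Lipschitz, hence Borel. -/
theorem measurable_of_isArgmin [BorelSpace E] {Ω : Type*} {mΩ : MeasurableSpace Ω} {W : Set E} {ν : E → ℝ}
    {dν : E → E →L[ℝ] ℝ} (hν : IsDistanceGenerating W ν dν) {ξ : Ω → E →L[ℝ] ℝ} {v : Ω → E}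
    (hξ : Measurable ξ) (h : ∀ ω, IsArgmin W (fun u => ξ ω u + ν u) (v ω)) : Measurable v := by
  let S : Set (E →L[ℝ] ℝ) := {ξ | ∃ v, IsArgmin W (fun u => ξ u + ν u) v}
  choose A hA using fun ξ : S => ξ.2
  have hLip : LipschitzWith 1 A := LipschitzWith.of_dist_le_mul fun ξ₁ ξ₂ => by
    rw [dist_eq_norm, Subtype.dist_eq, dist_eq_norm, NNReal.coe_one, one_mul]
    exact (hA ξ₁).norm_sub_le hν (hA ξ₂)
  have hv : v = fun ω => A ⟨ξ ω, v ω, h ω⟩ := by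
    funext ω
    have := (h ω).norm_sub_le hν (hA ⟨ξ ω, v ω, h ω⟩)
    rw [sub_self, norm_zero] at this
    exact sub_eq_zero.1 (norm_le_zero_iff.1 this)
  rw [hv]
  exact hLip.continuous.measurable.comp (hξ.subtype_mk)

theorem measurable_gradW [FiniteDimensional ℝ E] {Ω : Type*} {mΩ : MeasurableSpace Ω} {W : Set E}
    {dloss : E → Z → E →L[ℝ] ℝ} (hd : Measurable fun x : W × Z => dloss (x.1 : E) x.2)
    {w : Ω → E} (hwW : ∀ ω, w ω ∈ W) (hw : Measurable w) {q : Ω → Fin m → ℝ} (hq : Measurable q)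
    {x : Ω → Fin m → Bool × Z} (hx : Measurable x) :
    Measurable fun ω => gradW dloss (fun i => (x ω i).1) (fun i => (x ω i).2) (w ω) (q ω) := by
  have hprop : ProperSpace E := FiniteDimensional.proper_real E
  unfold gradW
  refine Finset.measurable_sum _ fun i _ => ?_
  have hxi : Measurable fun ω => x ω i := (measurable_pi_apply i).comp hx
  refine Measurable.ite ((measurable_fst.comp hxi) (measurableSet_singleton true)) ?_
    measurable_const
  refine ((measurable_pi_apply i).comp hq).smul ?_
  exact hd.comp ((hw.subtype_mk (h := hwW)).prodMk (measurable_snd.comp hxi))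

theorem measurable_gradQ {E Ω : Type*} [MeasurableSpace E] {mΩ : MeasurableSpace Ω} {W : Set E}
    {loss : E → Z → ℝ} (hl : Measurable fun x : W × Z => loss (x.1 : E) x.2)
    {w : Ω → E} (hwW : ∀ ω, w ω ∈ W) (hw : Measurable w)
    {x : Ω → Fin m → Bool × Z} (hx : Measurable x) :
    Measurable fun ω => gradQ loss (fun i => (x ω i).1) (fun i => (x ω i).2) (w ω) := by
  refine measurable_pi_iff.2 fun i => ?_
  have hxi : Measurable fun ω => x ω i := (measurable_pi_apply i).comp hx
  refine Measurable.ite ((measurable_fst.comp hxi) (measurableSet_singleton true)) ?_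
    measurable_const
  exact hl.comp ((hw.subtype_mk (h := hwW)).prodMk (measurable_snd.comp hxi))

theorem measurable_expWeights {Ω : Type*} {mΩ : MeasurableSpace Ω} {q x : Ω → Fin m → ℝ}
    (hq : Measurable q) (hx : Measurable x) : Measurable fun ω => expWeights (q ω) (x ω) := by
  have hqi : ∀ i, Measurable fun ω => q ω i := fun i => (measurable_pi_apply i).comp hq
  have hxi : ∀ i, Measurable fun ω => x ω i := fun i => (measurable_pi_apply i).comp hx
  refine measurable_pi_iff.2 fun i => ?_
  unfold expWeights
  exact ((hqi i).mul (hxi i).exp).div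
    (Finset.measurable_sum _ fun j _ => (hqi j).mul (hxi j).exp)

end Measurability

/-! ### Iterates: feasibility and dependence on earlier draws only. -/

section Run

variable {E : Type*} [NormedAddCommGroup E] [NormedSpace ℝ E] {Z : Type*} {m T : ℕ}
  {W : Set E} {ν : E → ℝ} {dν : E → E →L[ℝ] ℝ} {loss : E → Z → ℝ} {dloss : E → Z → E →L[ℝ] ℝ}
  {ηw ηq : ℝ}

theorem IsSMDRun.mem_subgradientDomain {b : Fin T → Fin m → Bool} {z : Fin T → Fin m → Z}
    {w : ℕ → E} {q : ℕ → Fin m → ℝ} (h : IsSMDRun W ν dν loss dloss ηw ηq T b z w q) {t : ℕ}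
    (ht : t ≤ T) : w t ∈ subgradientDomain W ν := by
  cases t with
  | zero =>
    refine IsArgmin.mem_subgradientDomain (ξ := 0) ?_
    simpa using h.init_w
  | succ t => exact (h.step_w ⟨t, ht⟩).of_mirrorStep.mem_subgradientDomain

theorem IsSMDRun.mem {b : Fin T → Fin m → Bool} {z : Fin T → Fin m → Z}
    {w : ℕ → E} {q : ℕ → Fin m → ℝ} (h : IsSMDRun W ν dν loss dloss ηw ηq T b z w q) {t : ℕ}
    (ht : t ≤ T) : w t ∈ W :=
  (h.mem_subgradientDomain ht).1

theorem IsSMDRun.q_mem [NeZero m] {b : Fin T → Fin m → Bool} {z : Fin T → Fin m → Z}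
    {w : ℕ → E} {q : ℕ → Fin m → ℝ} (h : IsSMDRun W ν dν loss dloss ηw ηq T b z w q) {t : ℕ}
    (ht : t ≤ T) : q t ∈ stdSimplex ℝ (Fin m) ∧ ∀ i, 0 < q t i := by
  have hm : (0 : ℝ) < m := by exact_mod_cast Nat.pos_of_ne_zero (NeZero.ne m)
  induction t with
  | zero =>
    rw [h.init_q]
    refine ⟨⟨fun i => ?_, ?_⟩, fun i => ?_⟩
    · positivity
    · simp [hm.ne']
    · positivity
  | succ t ih =>
    have hq := ih (by omega)
    have := eq_expWeights_of_isArgmin hq.1 hq.2 (h.step_q ⟨t, ht⟩)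
    simp only at this
    rw [this]
    exact expWeights_mem hq.1 hq.2 _

theorem IsSMDRun.q_succ [NeZero m] {b : Fin T → Fin m → Bool} {z : Fin T → Fin m → Z}
    {w : ℕ → E} {q : ℕ → Fin m → ℝ} (h : IsSMDRun W ν dν loss dloss ηw ηq T b z w q) (t : Fin T) :
    q (t + 1) = expWeights (q t) fun i => ηq * gradQ loss (b t) (z t) (w t) i :=
  eq_expWeights_of_isArgmin (h.q_mem t.2.le).1 (h.q_mem t.2.le).2 (h.step_q t)

theorem IsSMDRun.measurable {Ω : Type*} [MeasurableSpace Z] [MeasurableSpace E] [BorelSpace E]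
    [FiniteDimensional ℝ E] [NeZero m] [NeZero T] (hν : IsDistanceGenerating W ν dν)
    (hl : Measurable fun x : W × Z => loss (x.1 : E) x.2)
    (hd : Measurable fun x : W × Z => dloss (x.1 : E) x.2)
    {b : Fin T → Fin m → Ω → Bool} {z : Fin T → Fin m → Ω → Z} {w : ℕ → Ω → E}
    {q : ℕ → Ω → Fin m → ℝ}
    (h : ∀ ω, IsSMDRun W ν dν loss dloss ηw ηq T (fun t i => b t i ω) (fun t i => z t i ω)
      (fun t => w t ω) (fun t => q t ω)) {t : ℕ} (ht : t ≤ T) :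
    Measurable[drawSigma b z (Set.Iio t)] (w t) ∧ Measurable[drawSigma b z (Set.Iio t)] (q t) := by
  have hprop : ProperSpace E := FiniteDimensional.proper_real E
  induction t with
  | zero =>
    constructor
    · refine measurable_of_isArgmin hν (ξ := fun _ => 0) measurable_const fun ω => ?_
      simpa using (h ω).init_w
    · have : q 0 = fun _ _ => 1 / (m : ℝ) := funext fun ω => (h ω).init_q
      rw [this]
      exact measurable_const
  | succ t ih =>
    have hle : drawSigma b z (Set.Iio t) ≤ drawSigma b z (Set.Iio (t + 1)) :=
      drawSigma_mono (Set.Iio_subset_Iio (Nat.le_succ t))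
    have hw := (ih (by omega)).1.mono hle le_rfl
    have hq := (ih (by omega)).2.mono hle le_rfl
    have hx : Measurable[drawSigma b z (Set.Iio (t + 1))] (draw b z t) :=
      measurable_draw ht (Nat.lt_succ_self t)
    have hT : Fin.ofNat T t = ⟨t, ht⟩ := Fin.ext (Nat.mod_eq_of_lt ht)
    have hwW : ∀ ω, w t ω ∈ W := fun ω => (h ω).mem (by omega)
    constructor
    · refine measurable_of_isArgmin hν (ξ := fun ω => ηw • gradW dloss
        (fun i => (draw b z t ω i).1) (fun i => (draw b z t ω i).2) (w t ω) (q t ω)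
        - dν (w t ω)) ?_ fun ω => ?_
      · refine ((measurable_gradW hd hwW hw hq hx).const_smul ηw).sub ?_
        -- The gradient `dν` is known to be continuous only on the subgradient domain, which
        -- contains every iterate.
        have hc := (continuousOn_iff_continuous_domRestrict.1 hν.continuousOn_gradient).measurable
        exact hc.comp (hw.subtype_mk
          (h := fun ω => (h ω).mem_subgradientDomain (by omega : t ≤ T)))
      · have := ((h ω).step_w ⟨t, ht⟩).of_mirrorStep
        simpa only [draw, hT] using this
    · have : q (t + 1) = fun ω => expWeights (q t ω) (ηq • gradQ loss
          (fun i => (draw b z t ω i).1) (fun i => (draw b z t ω i).2) (w t ω)) := by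
        funext ω
        have := (h ω).q_succ ⟨t, ht⟩
        simp only [draw, hT]
        exact this
      rw [this]
      exact measurable_expWeights hq ((measurable_gradQ hl hwW hw hx).const_smul ηq)

end Run

/-! ### The gradient inequality for the risk. -/

section Risk

variable {E Z : Type*} [MeasurableSpace Z]

theorem measurable_section [MeasurableSpace E] {W : Set E} {F : Type*} [MeasurableSpace F] {f : E → Z → F}
    (hf : Measurable fun x : W × Z => f (x.1 : E) x.2) {w : E} (hw : w ∈ W) : Measurable (f w) :=
  hf.comp (measurable_const.prodMk measurable_id : Measurable fun x => ((⟨w, hw⟩ : W), x))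

theorem risk_mem_Icc {W : Set E} {P : Measure Z} [IsProbabilityMeasure P] {loss : E → Z → ℝ}
    (hb : ∀ᵐ x ∂P, ∀ w ∈ W, 0 ≤ loss w x ∧ loss w x ≤ 1) {w : E} (hw : w ∈ W) :
    0 ≤ risk loss P w ∧ risk loss P w ≤ 1 := by
  constructor
  · exact integral_nonneg_of_ae (by filter_upwards [hb] with x hx using (hx w hw).1)
  · refine (integral_mono_of_nonneg (g := fun _ => (1 : ℝ)) ?_ (integrable_const _) ?_).trans (by simp)
    · filter_upwards [hb] with x hx using (hx w hw).1
    · filter_upwards [hb] with x hx using (hx w hw).2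

/-- Only the risk is convex, not each loss, so the derivative must be taken under the integral:
difference quotients along the segment are dominated by `G * ‖u - w‖` through the mean value
inequality. -/
theorem risk_sub_le [NormedAddCommGroup E] [NormedSpace ℝ E] [MeasurableSpace E] {W : Set E} {P : Measure Z} [IsProbabilityMeasure P] {loss : E → Z → ℝ}
    {dloss : E → Z → E →L[ℝ] ℝ} (hl : Measurable fun x : W × Z => loss (x.1 : E) x.2)
    (hgrad : ∀ᵐ x ∂P, ∀ w ∈ W, HasFDerivWithinAt (fun u => loss u x) (dloss w x) W w)
    (hconv : ConvexOn ℝ W (risk loss P))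
    (hb : ∀ᵐ x ∂P, ∀ w ∈ W, 0 ≤ loss w x ∧ loss w x ≤ 1)
    {G : ℝ} (hG : ∀ᵐ x ∂P, ∀ w ∈ W, ‖dloss w x‖ ≤ G) {w u : E} (hw : w ∈ W) (hu : u ∈ W) :
    risk loss P w - risk loss P u ≤ ∫ x, dloss w x (w - u) ∂P := by
  have hint : ∀ v ∈ W, Integrable (loss v) P := fun v hv =>
    Integrable.of_bound (measurable_section hl hv).aestronglyMeasurable 1 (by
      filter_upwards [hb] with x hx
      rw [Real.norm_eq_abs, abs_of_nonneg (hx v hv).1]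
      exact (hx v hv).2)
  have hseg : ∀ᶠ s : ℝ in 𝓝[>] 0, 0 < s ∧ s ≤ 1 ∧ w + s • (u - w) ∈ W := by
    filter_upwards [Ioo_mem_nhdsGT (zero_lt_one' ℝ)] with s hs
    exact ⟨hs.1, hs.2.le, hconv.1.add_smul_sub_mem hw hu ⟨hs.1.le, hs.2.le⟩⟩
  have hlim : Tendsto (fun s : ℝ => ∫ x, s⁻¹ * (loss (w + s • (u - w)) x - loss w x) ∂P) (𝓝[>] 0)
      (𝓝 (∫ x, dloss w x (u - w) ∂P)) := by
    refine tendsto_integral_filter_of_dominated_convergence (fun _ => G * ‖u - w‖) ?_ ?_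
      (integrable_const _) ?_
    · filter_upwards [hseg] with s hs
      exact (((hint _ hs.2.2).sub (hint w hw)).const_mul _).aestronglyMeasurable
    · filter_upwards [hseg] with s hs
      filter_upwards [hgrad, hG] with x h1 h2
      have := hconv.1.norm_image_sub_le_of_norm_hasFDerivWithin_le h1 h2 hw hs.2.2
      rw [add_sub_cancel_left, norm_smul, Real.norm_eq_abs s, abs_of_pos hs.1] at this
      rw [norm_mul, norm_inv, Real.norm_eq_abs s, abs_of_pos hs.1, inv_mul_le_iff₀ hs.1]
      linarith
    · filter_upwards [hgrad] with x h1
      exact tendsto_slope_segment hconv.1 (h1 w hw) hw hu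
  have hle : ∫ x, dloss w x (u - w) ∂P ≤ risk loss P u - risk loss P w := by
    refine le_of_tendsto hlim ?_
    filter_upwards [hseg] with s hs
    rw [integral_const_mul, integral_sub (hint _ hs.2.2) (hint w hw), inv_mul_le_iff₀ hs.1]
    have h := hconv.2 hw hu (sub_nonneg.2 hs.2.1) hs.1.le (by ring)
    have he : (1 - s) • w + s • u = w + s • (u - w) := by module
    rw [he] at h
    simp only [smul_eq_mul, risk] at h ⊢
    linarith
  have hneg : ∫ x, dloss w x (w - u) ∂P = -∫ x, dloss w x (u - w) ∂P := by
    rw [← integral_neg]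
    exact integral_congr_ae (Eventually.of_forall fun x => by simp)
  rw [hneg]
  linarith

end Risk

/-! ### Tail bound for the sampling noise along the iterates. -/

section Noise

variable {E : Type*} [NormedAddCommGroup E] [NormedSpace ℝ E] [FiniteDimensional ℝ E]
  [MeasurableSpace E] [BorelSpace E] {Z : Type*} [MeasurableSpace Z] {Ω : Type*}
  [MeasurableSpace Ω] {μ : Measure Ω} [IsProbabilityMeasure μ] {m T : ℕ} [NeZero m] [NeZero T]
  {W : Set E} {ν : E → ℝ} {dν : E → E →L[ℝ] ℝ} {P : Fin m → Measure Z} {p : Fin m → ℝ}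
  {loss : E → Z → ℝ} {dloss : E → Z → E →L[ℝ] ℝ} {ηw ηq : ℝ}
  {b : Fin T → Fin m → Ω → Bool} {z : Fin T → Fin m → Ω → Z} {w : ℕ → Ω → E}
  {q : ℕ → Ω → Fin m → ℝ}

/-- The accumulated difference between the expectation of `∑_{i : bᵢ = 1} fᵢ(w, q; zᵢ)` at the
iterates and its realization. -/
def noise (P : Fin m → Measure Z) (p : Fin m → ℝ) (f : E → (Fin m → ℝ) → Fin m → Z → ℝ)
    (b : Fin T → Fin m → Ω → Bool) (z : Fin T → Fin m → Ω → Z) (w : ℕ → Ω → E)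
    (q : ℕ → Ω → Fin m → ℝ) (ω : Ω) : ℝ :=
  ∑ t ∈ Finset.range T, (∑ i, p i * ∫ x, f (w t ω) (q t ω) i x ∂P i
    - ∑ i, if (draw b z t ω i).1 = true then f (w t ω) (q t ω) i (draw b z t ω i).2 else 0)

theorem noise_tail (hν : IsDistanceGenerating W ν dν)
    (hl : Measurable fun x : W × Z => loss (x.1 : E) x.2)
    (hd : Measurable fun x : W × Z => dloss (x.1 : E) x.2)
    (hsamp : IsSampling μ P p T b z) (hp : ∀ i, 0 < p i)
    (hrun : ∀ ω, IsSMDRun W ν dν loss dloss ηw ηq T (fun t i => b t i ω) (fun t i => z t i ω)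
      (fun t => w t ω) (fun t => q t ω))
    {f : E → (Fin m → ℝ) → Fin m → Z → ℝ}
    (hf : ∀ i, Measurable fun x : (W × stdSimplex ℝ (Fin m)) × Z =>
      f (x.1.1 : E) (x.1.2 : Fin m → ℝ) i x.2)
    {a : E → (Fin m → ℝ) → Fin m → ℝ}
    (ha : ∀ v ∈ W, ∀ r ∈ stdSimplex ℝ (Fin m), ∀ i, ∀ᵐ x ∂P i, |f v r i x| ≤ a v r i)
    (ha0 : ∀ v ∈ W, ∀ r ∈ stdSimplex ℝ (Fin m), ∀ i, 0 ≤ a v r i)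
    {c : ℝ} (hc : 0 ≤ c) (hac : ∀ v ∈ W, ∀ r ∈ stdSimplex ℝ (Fin m), ∑ i, a v r i ≤ c)
    {s : ℝ} (hs : 0 < s) (l : ℝ) :
    μ.real {ω | s * T * c ^ 2 / 2 + l / s ≤ noise P p f b z w q ω} ≤ Real.exp (-l) := by
  -- Nothing is known about iterates beyond round `T`; capping the index keeps the state in `W`
  -- times the simplex for every `t`.
  let H : ℕ → Ω → W × stdSimplex ℝ (Fin m) := fun t ω =>
    (⟨w (min t T) ω, (hrun ω).mem (min_le_right t T)⟩,
      ⟨q (min t T) ω, ((hrun ω).q_mem (min_le_right t T)).1⟩)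
  let Y : W × stdSimplex ℝ (Fin m) → (Fin m → Bool × Z) → ℝ := fun h x =>
    ∑ i, if (x i).1 = true then f (h.1 : E) (h.2 : Fin m → ℝ) i (x i).2 else 0
  have hH : ∀ t < T, Measurable[drawSigma b z (Set.Iio t)] (H t) := by
    intro t ht
    have h := IsSMDRun.measurable hν hl hd hrun ht.le
    have e : min t T = t := min_eq_left ht.le
    refine Measurable.prodMk ?_ ?_
    · refine Measurable.subtype_mk ?_
      rw [e]; exact h.1
    · refine Measurable.subtype_mk ?_
      rw [e]; exact h.2
  have hY : Measurable (Function.uncurry Y) := by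
    refine Finset.measurable_sum _ fun i _ => ?_
    have hxi : Measurable fun y : (W × stdSimplex ℝ (Fin m)) × (Fin m → Bool × Z) => y.2 i :=
      (measurable_pi_apply i).comp measurable_snd
    exact Measurable.ite ((measurable_fst.comp hxi) (measurableSet_singleton true))
      ((hf i).comp (measurable_fst.prodMk (measurable_snd.comp hxi))) measurable_const
  have hb : ∀ t < T, ∀ h, ∀ᵐ ω ∂μ, |Y h (draw b z t ω)| ≤ c := by
    intro t ht h
    have := fun i => hsamp.ae_of_ae (ha h.1 h.1.2 h.2 h.2.2 i) (Fin.ofNat T t)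
    filter_upwards [ae_all_iff.2 this] with ω hω
    refine (Finset.abs_sum_le_sum_abs _ _).trans
      ((Finset.sum_le_sum fun i _ => ?_).trans (hac h.1 h.1.2 h.2 h.2.2))
    split_ifs with hbi
    · exact hω i hbi
    · simpa using ha0 h.1 h.1.2 h.2 h.2.2 i
  have hmain := measureReal_sum_mean_sub_ge_le (fun t => drawSigma b z (Set.Iio t))
    (fun t t' htt' => drawSigma_mono (Set.Iio_subset_Iio htt')) (fun t => hsamp.drawSigma_le _) hH
    (fun t ht => measurable_draw ht (Nat.lt_succ_self t)) (fun t ht => hsamp.indep_draw ht) hY hc hb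
    hs l
  convert hmain using 5 with ω
  unfold noise
  refine Finset.sum_congr rfl fun t ht => ?_
  have e : min t T = t := min_eq_left (Finset.mem_range.1 ht).le
  have hv := (hrun ω).mem (Finset.mem_range.1 ht).le
  have hr := ((hrun ω).q_mem (Finset.mem_range.1 ht).le).1
  have hfi : ∀ i, Measurable (f (w t ω) (q t ω) i) := fun i => (hf i).comp
    (measurable_const.prodMk measurable_id : Measurable fun x : Z =>
      (((⟨w t ω, hv⟩, ⟨q t ω, hr⟩) : W × stdSimplex ℝ (Fin m)), x))
  have := hsamp.integral_sum_ite hp (Fin.ofNat T t) hfi (ha _ hv _ hr)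
  simp only [Y, H, e]
  rw [← this]
  rfl

end Noise

/-! ### Simplex facts, and linearization of the duality gap. -/

section Simplex

variable {m : ℕ}

theorem le_one_of_mem_stdSimplex {r : Fin m → ℝ} (hr : r ∈ stdSimplex ℝ (Fin m)) (i : Fin m) :
    r i ≤ 1 :=
  (Finset.single_le_sum (fun j _ => hr.1 j) (Finset.mem_univ i)).trans hr.2.le

theorem eq_one_of_mem_stdSimplex {r : Fin m → ℝ} (hr : r ∈ stdSimplex ℝ (Fin m)) (hm : m = 1)
    (i : Fin m) : r i = 1 := by
  subst hm
  have := hr.2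
  rwa [Fin.sum_univ_one, ← Subsingleton.elim i 0] at this

end Simplex

section Gap

variable {E : Type*} [NormedAddCommGroup E] [NormedSpace ℝ E] {Z : Type*} {m : ℕ}

/-- The directional derivative terms `qᵢ ⟨∇ℓ(w; z), w - u⟩`. -/
def gradTerm (dloss : E → Z → E →L[ℝ] ℝ) (u : E) : E → (Fin m → ℝ) → Fin m → Z → ℝ :=
  fun v r j x => r j * dloss v x (v - u)

/-- The terms `(eᵢ - q)ⱼ ℓ(w; z)`. -/
def lossTerm (loss : E → Z → ℝ) (i : Fin m) : E → (Fin m → ℝ) → Fin m → Z → ℝ :=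
  fun v r j x => ((Pi.single i 1 : Fin m → ℝ) j - r j) * loss v x

theorem sum_gradTerm (dloss : E → Z → E →L[ℝ] ℝ) (u v : E) (r : Fin m → ℝ)
    (x : Fin m → Bool × Z) :
    (∑ j, if (x j).1 = true then gradTerm dloss u v r j (x j).2 else 0)
      = gradW dloss (fun j => (x j).1) (fun j => (x j).2) v r (v - u) := by
  rw [gradW, sum_apply]
  refine Finset.sum_congr rfl fun j _ => ?_
  split_ifs <;> simp [gradTerm]

theorem sum_lossTerm {E : Type*} (loss : E → Z → ℝ) (i : Fin m) (v : E) (r : Fin m → ℝ)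
    (x : Fin m → Bool × Z) :
    (∑ j, if (x j).1 = true then lossTerm loss i v r j (x j).2 else 0)
      = gradQ loss (fun j => (x j).1) (fun j => (x j).2) v i
        - ∑ j, r j * gradQ loss (fun j => (x j).1) (fun j => (x j).2) v j := by
  have h : ∀ j, (if (x j).1 = true then lossTerm loss i v r j (x j).2 else 0) =
      (Pi.single i 1 : Fin m → ℝ) j * gradQ loss (fun j => (x j).1) (fun j => (x j).2) v j
        - r j * gradQ loss (fun j => (x j).1) (fun j => (x j).2) v j := by
    intro j
    unfold gradQ lossTerm
    split_ifs <;> ring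
  simp_rw [h, Finset.sum_sub_distrib, Pi.single_apply, ite_mul, one_mul, zero_mul]
  simp

theorem norm_gradW_le {W : Set E} {dloss : E → Z → E →L[ℝ] ℝ} {b : Fin m → Bool} {z : Fin m → Z}
    {v : E} (hv : v ∈ W) {r : Fin m → ℝ} (hr : r ∈ stdSimplex ℝ (Fin m)) {G : ℝ} (hG0 : 0 ≤ G)
    (hG : ∀ i, b i = true → ∀ v ∈ W, ‖dloss v (z i)‖ ≤ G) :
    ‖gradW dloss b z v r‖ ≤ G := by
  calc ‖gradW dloss b z v r‖ ≤ ∑ i, r i * G := by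
        refine norm_sum_le_of_le _ fun i _ => ?_
        split_ifs with h
        · rw [norm_smul, Real.norm_eq_abs, abs_of_nonneg (hr.1 i)]
          exact mul_le_mul_of_nonneg_left (hG i h v hv) (hr.1 i)
        · simpa using mul_nonneg (hr.1 i) hG0
    _ = G := by rw [← Finset.sum_mul, hr.2, one_mul]

variable [MeasurableSpace Z] [MeasurableSpace E]

/-- The passage from `r` to the vertex `e_i` is exact by linearity and gives the loss terms; only
the passage from `v` to `u` uses convexity. -/
theorem gap_le {W : Set E} {P : Fin m → Measure Z} [∀ i, IsProbabilityMeasure (P i)]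
    {p : Fin m → ℝ} (hp : ∀ i, 0 ≤ p i) {loss : E → Z → ℝ}
    {dloss : E → Z → E →L[ℝ] ℝ} (hl : Measurable fun x : W × Z => loss (x.1 : E) x.2)
    (hgrad : ∀ i, ∀ᵐ x ∂P i, ∀ w ∈ W, HasFDerivWithinAt (fun u => loss u x) (dloss w x) W w)
    (hconv : ∀ i, ConvexOn ℝ W (risk loss (P i)))
    (hb : ∀ i, ∀ᵐ x ∂P i, ∀ w ∈ W, 0 ≤ loss w x ∧ loss w x ≤ 1)
    {G : ℝ} (hG : ∀ i, ∀ᵐ x ∂P i, ∀ w ∈ W, ‖dloss w x‖ ≤ G) {v u : E} (hv : v ∈ W) (hu : u ∈ W)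
    {r : Fin m → ℝ} (hr : r ∈ stdSimplex ℝ (Fin m)) (i : Fin m) :
    p i * risk loss (P i) v - ∑ j, r j * p j * risk loss (P j) u ≤
      ∑ j, p j * ∫ x, gradTerm dloss u v r j x ∂P j
        + ∑ j, p j * ∫ x, lossTerm loss i v r j x ∂P j := by
  have h1 : p i * risk loss (P i) v
      = ∑ j, (Pi.single i 1 : Fin m → ℝ) j * (p j * risk loss (P j) v) := by
    simp [Pi.single_apply]
  rw [h1, ← Finset.sum_sub_distrib, ← Finset.sum_add_distrib]
  refine Finset.sum_le_sum fun j _ => ?_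
  have h2 := risk_sub_le hl (hgrad j) (hconv j) (hb j) (hG j) hv hu
  have h3 := mul_le_mul_of_nonneg_left h2 (mul_nonneg (hr.1 j) (hp j))
  simp only [gradTerm, lossTerm]
  rw [integral_const_mul, integral_const_mul]
  unfold risk at h3 ⊢
  linarith

end Gap

/-! ### The weighted objective and its inner supremum. -/

section Objective

variable {E Z : Type*} [MeasurableSpace Z] {m : ℕ} [NeZero m] {W : Set E} {loss : E → Z → ℝ}
  {P : Fin m → Measure Z} {n : Fin m → ℕ}

theorem scale_pos (hn : ∀ i, 0 < n i) (i : Fin m) : 0 < scale n i :=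
  div_pos (Nat.cast_pos.2 (hn i)) (Nat.cast_pos.2 (hn 0))

theorem weightedObjective_le_iSup [∀ i, IsProbabilityMeasure (P i)]
    (hb : ∀ i, ∀ᵐ x ∂P i, ∀ w ∈ W, 0 ≤ loss w x ∧ loss w x ≤ 1)
    (hn : ∀ i, 0 < n i) {u : E} (hu : u ∈ W) {r : Fin m → ℝ} (hr : r ∈ stdSimplex ℝ (Fin m)) :
    weightedObjective loss P n u r
      ≤ ⨆ r' : stdSimplex ℝ (Fin m), weightedObjective loss P n u (r' : Fin m → ℝ) := by
  refine le_ciSup (f := fun r' : stdSimplex ℝ (Fin m) =>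
    weightedObjective loss P n u (r' : Fin m → ℝ)) ⟨∑ i, scale n i, ?_⟩ ⟨r, hr⟩
  rintro _ ⟨r', rfl⟩
  refine Finset.sum_le_sum fun i _ => ?_
  have h1 := risk_mem_Icc (hb i) hu
  have h2 := le_one_of_mem_stdSimplex r'.2 i
  have h3 := r'.2.1 i
  have h4 := (scale_pos hn i).le
  calc _ ≤ 1 * scale n i * 1 :=
        mul_le_mul (mul_le_mul_of_nonneg_right h2 h4) h1.2 h1.1 (by linarith)
    _ = scale n i := by ring

theorem weightedObjective_single (u : E) (i : Fin m) :
    weightedObjective loss P n u (Pi.single i 1) = scale n i * risk loss (P i) u := by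
  simp [weightedObjective, Pi.single_apply]

end Objective

/-! ### Regret of the two players at step sizes `D ^ 2 * α` and `Real.log m * α`. -/

section Regret

variable {E : Type*} [NormedAddCommGroup E] [NormedSpace ℝ E] {Z : Type*} {m T : ℕ} [NeZero m]
  {W : Set E} {ν : E → ℝ} {dν : E → E →L[ℝ] ℝ} {loss : E → Z → ℝ} {dloss : E → Z → E →L[ℝ] ℝ}
  {ηw ηq : ℝ} {b : ℕ → Fin m → Bool} {z : ℕ → Fin m → Z} {w : ℕ → E} {q : ℕ → Fin m → ℝ}

theorem IsSMDRun.regret_w (hν : IsDistanceGenerating W ν dν) {D G α : ℝ} (hα : 0 < α)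
    (hD : ∀ u ∈ W, ∀ v ∈ W, ν u - ν v ≤ D ^ 2)
    (h : IsSMDRun W ν dν loss dloss (D ^ 2 * α) ηq T (fun t => b t) (fun t => z t) w q)
    (hG0 : 0 ≤ G) (hG : ∀ t < T, ∀ i, b t i = true → ∀ v ∈ W, ‖dloss v (z t i)‖ ≤ G)
    {u : E} (hu : u ∈ W) :
    ∑ t ∈ Finset.range T, gradW dloss (b t) (z t) (w t) (q t) (w t - u)
      ≤ 1 / α + α * T * (D ^ 2 * G ^ 2) / 2 := by
  -- For `D = 0` the step size vanishes and cannot be divided out, but then `W` is one point and the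
  -- regret is zero. The case `m = 1` for `q` is analogous.
  rcases eq_or_ne D 0 with rfl | hD0
  · have h0 : ∑ t ∈ Finset.range T, gradW dloss (b t) (z t) (w t) (q t) (w t - u) = 0 := by
      refine Finset.sum_eq_zero fun t ht => ?_
      have := sq_norm_sub_le hν.strongConvexOn hD (h.mem (Finset.mem_range.1 ht).le) hu
      have h1 : ‖w t - u‖ = 0 := by nlinarith [norm_nonneg (w t - u)]
      rw [norm_eq_zero.1 h1, map_zero]
    rw [h0]
    positivity
  · have hD2 : 0 < D ^ 2 := by positivity
    have h1 := mirrorDescent_regret hν hD (η := D ^ 2 * α) (G := G) (T := T)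
      (g := fun t => gradW dloss (b t) (z t) (w t) (q t)) h.init_w
      (fun t ht => h.step_w ⟨t, ht⟩)
      (fun t ht => norm_gradW_le (h.mem ht.le) (h.q_mem ht.le).1 hG0 (hG t ht)) hu
    have h2 : 0 < D ^ 2 * α := by positivity
    rw [← le_div_iff₀' h2] at h1
    refine h1.trans_eq ?_
    field_simp

theorem IsSMDRun.regret_q {α : ℝ} (hα : 0 < α)
    (h : IsSMDRun W ν dν loss dloss ηw (Real.log m * α) T (fun t => b t) (fun t => z t) w q)
    (hb : ∀ t < T, ∀ i, b t i = true → ∀ v ∈ W, 0 ≤ loss v (z t i) ∧ loss v (z t i) ≤ 1)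
    (i : Fin m) :
    ∑ t ∈ Finset.range T, (gradQ loss (b t) (z t) (w t) i
        - ∑ j, q t j * gradQ loss (b t) (z t) (w t) j)
      ≤ 1 / α + α * T * Real.log m / 2 := by
  have hm1 : 1 ≤ m := Nat.pos_of_ne_zero (NeZero.ne m)
  rcases hm1.eq_or_lt with hm | hm
  · have h0 : ∑ t ∈ Finset.range T, (gradQ loss (b t) (z t) (w t) i
        - ∑ j, q t j * gradQ loss (b t) (z t) (w t) j) = 0 := by
      refine Finset.sum_eq_zero fun t ht => ?_
      have hq := (h.q_mem (Finset.mem_range.1 ht).le).1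
      simp_rw [eq_one_of_mem_stdSimplex hq hm.symm]
      subst hm
      rw [Fin.sum_univ_one, Subsingleton.elim i 0]
      ring
    rw [h0, ← hm]
    simp [hα.le]
  · have hlog : 0 < Real.log m := Real.log_pos (by exact_mod_cast hm)
    have h1 := expWeights_regret (η := Real.log m * α) (T := T)
      (g := fun t => gradQ loss (b t) (z t) (w t)) h.init_q (fun t ht => (h.q_mem ht).1)
      (fun t ht => (h.q_mem ht).2) (fun t ht => h.q_succ ⟨t, ht⟩) (fun t ht j => by
        unfold gradQ
        split_ifs with hbj
        · exact hb t ht j hbj _ (h.mem ht.le)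
        · simp) i
    have h2 : 0 < Real.log m * α := by positivity
    rw [← le_div_iff₀' h2] at h1
    refine h1.trans_eq ?_
    field_simp

end Regret

/-! ### Explicit tails for the two noise sums. -/

section HighProbability

variable {E : Type*} [NormedAddCommGroup E] [NormedSpace ℝ E] [FiniteDimensional ℝ E]
  [MeasurableSpace E] [BorelSpace E] {Z : Type*} [MeasurableSpace Z] {Ω : Type*}
  [MeasurableSpace Ω] {μ : Measure Ω} [IsProbabilityMeasure μ] {m T : ℕ} [NeZero m] [NeZero T]
  {W : Set E} {ν : E → ℝ} {dν : E → E →L[ℝ] ℝ} {P : Fin m → Measure Z} {p : Fin m → ℝ}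
  {loss : E → Z → ℝ} {dloss : E → Z → E →L[ℝ] ℝ} {ηw ηq : ℝ}
  {b : Fin T → Fin m → Ω → Bool} {z : Fin T → Fin m → Ω → Z} {w : ℕ → Ω → E}
  {q : ℕ → Ω → Fin m → ℝ}

theorem measurable_eval_sub {v u : W → E} (hv : Measurable v) (hu : Measurable u)
    (hd : Measurable fun x : W × Z => dloss (x.1 : E) x.2) :
    Measurable fun x : W × Z => dloss (x.1 : E) x.2 (v x.1 - u x.1) := by
  have hprop : ProperSpace E := FiniteDimensional.proper_real E
  have hev : Measurable fun y : (E →L[ℝ] ℝ) × E => y.1 y.2 :=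
    (isBoundedBilinearMap_apply (𝕜 := ℝ) (E := E) (F := ℝ)).continuous.measurable
  exact hev.comp (hd.prodMk ((hv.comp measurable_fst).sub (hu.comp measurable_fst)))

theorem gradTerm_tail (hν : IsDistanceGenerating W ν dν) {D : ℝ}
    (hD : ∀ u ∈ W, ∀ v ∈ W, ν u - ν v ≤ D ^ 2)
    (hl : Measurable fun x : W × Z => loss (x.1 : E) x.2)
    (hd : Measurable fun x : W × Z => dloss (x.1 : E) x.2)
    (hsamp : IsSampling μ P p T b z) (hp : ∀ i, 0 < p i)
    (hrun : ∀ ω, IsSMDRun W ν dν loss dloss ηw ηq T (fun t i => b t i ω) (fun t i => z t i ω)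
      (fun t => w t ω) (fun t => q t ω))
    {G : ℝ} (hG0 : 0 ≤ G) (hG : ∀ i, ∀ᵐ x ∂P i, ∀ w ∈ W, ‖dloss w x‖ ≤ G)
    {u : E} (hu : u ∈ W) {K : ℝ} (hK : 0 < K) (hDK : D ^ 2 * G ^ 2 ≤ K) (l : ℝ) :
    μ.real {ω | (2 + 2 * l) * √(T * K) ≤ noise P p (gradTerm dloss u) b z w q ω}
      ≤ Real.exp (-l) := by
  have hT : (0 : ℝ) < T := Nat.cast_pos.2 (Nat.pos_of_ne_zero (NeZero.ne T))
  set S := √(T * K) with hSdef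
  have hS : 0 < S := Real.sqrt_pos.2 (mul_pos hT hK)
  have hS2 : S ^ 2 = T * K := Real.sq_sqrt (mul_pos hT hK).le
  have hdist : ∀ v ∈ W, ‖v - u‖ ≤ √(8 * D ^ 2) := fun v hv =>
    Real.le_sqrt_of_sq_le (sq_norm_sub_le hν.strongConvexOn hD hv hu)
  -- With the increment bound G√(8D²), the choice s = 1/(2S) makes the variance term at most 2S and
  -- the deviation term equal to 2lS.
  have h := noise_tail hν hl hd hsamp hp hrun (f := gradTerm dloss u)
    (a := fun _ r j => r j * (G * √(8 * D ^ 2))) (c := G * √(8 * D ^ 2))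
    (fun i => by
      have h1 : Measurable fun x : (W × stdSimplex ℝ (Fin m)) × Z => (x.1.2 : Fin m → ℝ) i :=
        (measurable_pi_apply i).comp
          (measurable_subtype_coe.comp (measurable_snd.comp measurable_fst))
      exact h1.mul ((measurable_eval_sub measurable_subtype_coe measurable_const hd).comp
        ((measurable_fst.comp measurable_fst).prodMk measurable_snd)))
    (fun v hv r hr i => by
      filter_upwards [hG i] with x hx
      rw [gradTerm, abs_mul, abs_of_nonneg (hr.1 i)]
      refine mul_le_mul_of_nonneg_left ?_ (hr.1 i)
      exact ((dloss v x).le_opNorm _).trans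
        (mul_le_mul (hx v hv) (hdist v hv) (norm_nonneg _) hG0))
    (fun v hv r hr i => mul_nonneg (hr.1 i) (by positivity))
    (by positivity)
    (fun v hv r hr => by rw [← Finset.sum_mul, hr.2, one_mul])
    (s := 1 / (2 * S)) (by positivity) l
  refine le_trans (measureReal_mono fun ω hω => ?_) h
  refine le_trans ?_ (Set.mem_ofPred_eq ▸ hω)
  have e : 1 / (2 * S) * T * (G * √(8 * D ^ 2)) ^ 2 / 2 + l / (1 / (2 * S))
      = 2 * (T * (D ^ 2 * G ^ 2)) / S + 2 * l * S := by
    rw [mul_pow, Real.sq_sqrt (by positivity)]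
    field_simp
    ring
  have h2 : 2 * (T * (D ^ 2 * G ^ 2)) / S ≤ 2 * S := by
    rw [div_le_iff₀ hS]
    nlinarith [mul_le_mul_of_nonneg_left hDK hT.le]
  rw [e]
  linarith

theorem lossTerm_tail (hν : IsDistanceGenerating W ν dν)
    (hl : Measurable fun x : W × Z => loss (x.1 : E) x.2)
    (hd : Measurable fun x : W × Z => dloss (x.1 : E) x.2)
    (hsamp : IsSampling μ P p T b z) (hp : ∀ i, 0 < p i)
    (hrun : ∀ ω, IsSMDRun W ν dν loss dloss ηw ηq T (fun t i => b t i ω) (fun t i => z t i ω)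
      (fun t => w t ω) (fun t => q t ω))
    (hb : ∀ i, ∀ᵐ x ∂P i, ∀ w ∈ W, 0 ≤ loss w x ∧ loss w x ≤ 1)
    {K : ℝ} (hK : 0 < K) (hmK : Real.log m ≤ K) {l : ℝ} (hl0 : 0 < l) (i : Fin m) :
    μ.real {ω | (3 + 3 / 2 * l) * √(T * K) ≤ noise P p (lossTerm loss i) b z w q ω}
      ≤ Real.exp (-(Real.log m + l)) := by
  have hT : (0 : ℝ) < T := Nat.cast_pos.2 (Nat.pos_of_ne_zero (NeZero.ne T))
  have hm1 : 1 ≤ m := Nat.pos_of_ne_zero (NeZero.ne m)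
  set S := √(T * K) with hSdef
  have hS : 0 < S := Real.sqrt_pos.2 (mul_pos hT hK)
  have hS2 : S ^ 2 = T * K := Real.sq_sqrt (mul_pos hT hK).le
  have hlog : 0 ≤ Real.log m := Real.log_nonneg (by exact_mod_cast hm1)
  have htail : ∀ c : ℝ, 0 ≤ c → (∀ r ∈ stdSimplex ℝ (Fin m),
      ∑ j, |(Pi.single i 1 : Fin m → ℝ) j - r j| ≤ c) → ∀ s : ℝ, 0 < s →
      μ.real {ω | s * T * c ^ 2 / 2 + (Real.log m + l) / s ≤ noise P p (lossTerm loss i) b z w q ω}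
        ≤ Real.exp (-(Real.log m + l)) := by
    intro c hc hsum s hs
    refine noise_tail hν hl hd hsamp hp hrun (f := lossTerm loss i)
      (a := fun _ r j => |(Pi.single i 1 : Fin m → ℝ) j - r j|) (c := c)
      (fun j => ?_) (fun v hv r hr j => ?_) (fun v hv r hr j => abs_nonneg _) hc
      (fun v hv r hr => hsum r hr) hs _
    · have h1 : Measurable fun x : (W × stdSimplex ℝ (Fin m)) × Z => (x.1.2 : Fin m → ℝ) j :=
        (measurable_pi_apply j).comp
          (measurable_subtype_coe.comp (measurable_snd.comp measurable_fst))
      exact (measurable_const.sub h1).mul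
        (hl.comp ((measurable_fst.comp measurable_fst).prodMk measurable_snd))
    · filter_upwards [hb j] with x hx
      rw [lossTerm, abs_mul, abs_of_nonneg (hx v hv).1]
      exact mul_le_of_le_one_right (abs_nonneg _) (hx v hv).2
  rcases hm1.eq_or_lt with hm | hm
  · have h0 : ∀ r ∈ stdSimplex ℝ (Fin m), ∑ j, |(Pi.single i 1 : Fin m → ℝ) j - r j| ≤ 0 := by
      intro r hr
      refine (Finset.sum_eq_zero fun j _ => ?_).le
      have hij : j = i := by subst hm; exact Subsingleton.elim j i
      rw [eq_one_of_mem_stdSimplex hr hm.symm, hij]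
      simp
    -- With one group the increments vanish, so `s` is free; it is chosen to make the deviation term
    -- equal to the threshold.
    refine le_trans (measureReal_mono fun ω hω => ?_)
      (htail 0 le_rfl h0 ((Real.log m + l) / ((3 + 3 / 2 * l) * S)) (by positivity))
    refine le_trans (le_of_eq ?_) (Set.mem_ofPred_eq ▸ hω)
    have : Real.log m + l ≠ 0 := by positivity
    field_simp
    ring
  · have h2 : ∀ r ∈ stdSimplex ℝ (Fin m), ∑ j, |(Pi.single i 1 : Fin m → ℝ) j - r j| ≤ 2 := by
      intro r hr
      calc _ ≤ ∑ j, (|(Pi.single i 1 : Fin m → ℝ) j| + |r j|) :=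
            Finset.sum_le_sum fun j _ => abs_sub _ _
        _ = 2 := by
            simp_rw [Finset.sum_add_distrib, abs_of_nonneg (hr.1 _), hr.2, Pi.single_apply]
            simp only [apply_ite abs, abs_one, abs_zero, Finset.sum_ite_eq', Finset.mem_univ, if_true]
            norm_num
    -- Two groups already give K ≥ log 2 ≥ 2/3, which is where the factor 3/2 in front of `l` comes
    -- from.
    have hKlog : 2 / 3 ≤ K := by
      have h3 : Real.log 2 ≤ Real.log m := Real.log_le_log (by norm_num) (by exact_mod_cast hm)
      linarith [Real.log_two_gt_d9]
    refine le_trans (measureReal_mono fun ω hω => ?_)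
      (htail 2 (by norm_num) h2 (K / S) (by positivity))
    refine le_trans ?_ (Set.mem_ofPred_eq ▸ hω)
    have e1 : K / S * T * 2 ^ 2 / 2 = 2 * S := by
      rw [div_mul_eq_mul_div, mul_comm K, ← hS2]
      field_simp
    have e2 : (Real.log m + l) / (K / S) = Real.log m / K * S + l / K * S := by
      field_simp
    have e3 : Real.log m / K ≤ 1 := (div_le_one hK).2 hmK
    have e4 : l / K ≤ 3 / 2 * l := by
      rw [div_le_iff₀ hK]
      nlinarith
    rw [e1, e2]
    nlinarith

end HighProbability

/-! ### From the gap to regret plus noise. -/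

section Gap

variable {E : Type*} [NormedAddCommGroup E] [NormedSpace ℝ E] [MeasurableSpace E] {Z : Type*}
  [MeasurableSpace Z] {Ω : Type*} {m T : ℕ} [NeZero m] [NeZero T] {W : Set E} {ν : E → ℝ}
  {dν : E → E →L[ℝ] ℝ} {P : Fin m → Measure Z} {p : Fin m → ℝ} {loss : E → Z → ℝ}
  {dloss : E → Z → E →L[ℝ] ℝ} {b : Fin T → Fin m → Ω → Bool} {z : Fin T → Fin m → Ω → Z}
  {w : ℕ → Ω → E} {q : ℕ → Ω → Fin m → ℝ}

theorem weightedGap_le_noise [∀ i, IsProbabilityMeasure (P i)]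
    (hν : IsDistanceGenerating W ν dν) {D G α : ℝ} (hα : 0 < α)
    (hD : ∀ u ∈ W, ∀ v ∈ W, ν u - ν v ≤ D ^ 2)
    (hl : Measurable fun x : W × Z => loss (x.1 : E) x.2) (hp : ∀ i, 0 ≤ p i)
    (hgrad : ∀ i, ∀ᵐ x ∂P i, ∀ w ∈ W, HasFDerivWithinAt (fun u => loss u x) (dloss w x) W w)
    (hconv : ∀ i, ConvexOn ℝ W (risk loss (P i)))
    (hb : ∀ i, ∀ᵐ x ∂P i, ∀ w ∈ W, 0 ≤ loss w x ∧ loss w x ≤ 1)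
    (hG0 : 0 ≤ G) (hG : ∀ i, ∀ᵐ x ∂P i, ∀ w ∈ W, ‖dloss w x‖ ≤ G)
    {ω : Ω} (hrun : IsSMDRun W ν dν loss dloss (D ^ 2 * α) (Real.log m * α) T
      (fun t i => b t i ω) (fun t i => z t i ω) (fun t => w t ω) (fun t => q t ω))
    (hbω : ∀ t i, b t i ω = true → ∀ w ∈ W, 0 ≤ loss w (z t i ω) ∧ loss w (z t i ω) ≤ 1)
    (hGω : ∀ t i, b t i ω = true → ∀ w ∈ W, ‖dloss w (z t i ω)‖ ≤ G)
    {u : E} (hu : u ∈ W) (i : Fin m) :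
    ∑ t ∈ Finset.range T, (p i * risk loss (P i) (w t ω)
        - ∑ j, q t ω j * p j * risk loss (P j) u)
      ≤ noise P p (gradTerm dloss u) b z w q ω + noise P p (lossTerm loss i) b z w q ω
        + (2 / α + α * T * (D ^ 2 * G ^ 2 + Real.log m) / 2) := by
  have hrun' : IsSMDRun W ν dν loss dloss (D ^ 2 * α) (Real.log m * α) T
      (fun t : Fin T => fun i => (draw b z t ω i).1) (fun t : Fin T => fun i => (draw b z t ω i).2)
      (fun t => w t ω) (fun t => q t ω) := by
    simpa only [draw, Fin.ofNat_val_eq_self] using hrun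
  have h1 := hrun'.regret_w (b := fun t i => (draw b z t ω i).1)
    (z := fun t i => (draw b z t ω i).2) hν hα hD hG0 (fun t _ i => hGω _ i) hu
  have h2 := hrun'.regret_q (b := fun t i => (draw b z t ω i).1)
    (z := fun t i => (draw b z t ω i).2) hα (fun t _ i => hbω _ i) i
  have h3 : ∑ t ∈ Finset.range T, (p i * risk loss (P i) (w t ω)
        - ∑ j, q t ω j * p j * risk loss (P j) u) ≤
      ∑ t ∈ Finset.range T, (∑ j, p j * ∫ x, gradTerm dloss u (w t ω) (q t ω) j x ∂P j
        + ∑ j, p j * ∫ x, lossTerm loss i (w t ω) (q t ω) j x ∂P j) :=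
    Finset.sum_le_sum fun t ht => gap_le hp hl hgrad hconv hb hG
      (hrun.mem (Finset.mem_range.1 ht).le) hu (hrun.q_mem (Finset.mem_range.1 ht).le).1 i
  have hA : noise P p (gradTerm dloss u) b z w q ω = _ :=
    (Finset.sum_congr rfl fun t _ => by rw [sum_gradTerm]).trans (Finset.sum_sub_distrib _ _)
  have hB : noise P p (lossTerm loss i) b z w q ω = _ :=
    (Finset.sum_congr rfl fun t _ => by rw [sum_lossTerm]).trans (Finset.sum_sub_distrib _ _)
  rw [Finset.sum_add_distrib] at h3
  rw [hA, hB]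
  have e : 2 / α + α * T * (D ^ 2 * G ^ 2 + Real.log m) / 2 =
    (1 / α + α * T * (D ^ 2 * G ^ 2) / 2) + (1 / α + α * T * Real.log m / 2) := by ring
  rw [e]
  linarith

end Gap

/-! ### Averaging, the resulting rate and the degenerate case. -/

section Average

variable {E : Type*} [NormedAddCommGroup E] [NormedSpace ℝ E] {W : Set E}

theorem average_risk_le {f : E → ℝ} (hf : ConvexOn ℝ W f) {w : ℕ → E} {T : ℕ} (hT : 0 < T)
    (hw : ∀ t < T, w t ∈ W) : T * f (average w T) ≤ ∑ t ∈ Finset.range T, f (w t) := by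
  have hT' : (0 : ℝ) < T := Nat.cast_pos.2 hT
  have h := hf.map_sum_le (t := Finset.range T) (w := fun _ => (T : ℝ)⁻¹) (p := w)
    (fun _ _ => by positivity) (by simp [hT'.ne']) (fun t ht => hw t (Finset.mem_range.1 ht))
  rw [← Finset.smul_sum, ← Finset.smul_sum, smul_eq_mul] at h
  rwa [← le_inv_mul_iff₀ hT']

end Average

/-- With S = √(TK) the left side is (2/√1.6 + √1.6/2) S, about 2.21 S. -/
theorem regret_rate_le {T K : ℝ} (hT : 0 < T) (hK : 0 < K) :
    2 / √(8 / (5 * T * K)) + √(8 / (5 * T * K)) * T * K / 2 ≤ 7 / 3 * √(T * K) := by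
  have hTK := mul_pos hT hK
  set S := √(T * K) with hSdef
  have hS : 0 < S := Real.sqrt_pos.2 hTK
  have hS2 : S ^ 2 = T * K := Real.sq_sqrt hTK.le
  have e : √(8 / (5 * T * K)) = √(8 / 5) / S := by
    rw [hSdef, ← Real.sqrt_div (by norm_num)]
    congr 1
    field_simp
  have h1 : 6 / 5 ≤ √(8 / 5 : ℝ) := Real.le_sqrt_of_sq_le (by norm_num)
  have h2 : √(8 / 5 : ℝ) ≤ 13 / 10 := Real.sqrt_le_iff.2 ⟨by norm_num, by norm_num⟩
  have e1 : √(8 / 5) / S * T * K / 2 = √(8 / 5) / 2 * S := by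
    rw [mul_assoc _ T K, ← hS2]
    field_simp
  have e2 : 2 / (√(8 / 5) / S) = 2 / √(8 / 5) * S := by field_simp
  have h3 : 2 / √(8 / 5 : ℝ) ≤ 5 / 3 := by
    rw [div_le_iff₀ (by linarith)]
    linarith
  rw [e, e1, e2]
  nlinarith

section Degenerate

variable {E : Type*} [NormedAddCommGroup E] [NormedSpace ℝ E] [MeasurableSpace E]
  {Z : Type*} [MeasurableSpace Z] {W : Set E}

/-- Either `W` is a point or the gradients vanish; both cases are covered by `G * ‖v - u‖ = 0`. -/
theorem risk_le_of_mul_eq_zero {ν : E → ℝ} (hν : StrongConvexOn W 1 ν) {D G : ℝ}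
    (hD : ∀ u ∈ W, ∀ v ∈ W, ν u - ν v ≤ D ^ 2) {P : Measure Z} [IsProbabilityMeasure P]
    {loss : E → Z → ℝ} {dloss : E → Z → E →L[ℝ] ℝ}
    (hl : Measurable fun x : W × Z => loss (x.1 : E) x.2)
    (hgrad : ∀ᵐ x ∂P, ∀ w ∈ W, HasFDerivWithinAt (fun u => loss u x) (dloss w x) W w)
    (hconv : ConvexOn ℝ W (risk loss P))
    (hb : ∀ᵐ x ∂P, ∀ w ∈ W, 0 ≤ loss w x ∧ loss w x ≤ 1)
    (hG : ∀ᵐ x ∂P, ∀ w ∈ W, ‖dloss w x‖ ≤ G) (hDG : D ^ 2 * G ^ 2 = 0)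
    {v u : E} (hv : v ∈ W) (hu : u ∈ W) : risk loss P v ≤ risk loss P u := by
  have h1 := risk_sub_le hl hgrad hconv hb hG hv hu
  have h2 : G * ‖v - u‖ = 0 := by
    have h3 := mul_le_mul_of_nonneg_left (sq_norm_sub_le hν hD hv hu) (sq_nonneg G)
    have h4 : (G * ‖v - u‖) ^ 2 ≤ 0 := by nlinarith
    exact pow_eq_zero_iff two_ne_zero |>.1 (le_antisymm h4 (sq_nonneg _))
  have h5 : ∫ x, dloss v x (v - u) ∂P ≤ 0 := by
    refine integral_nonpos_of_ae ?_
    filter_upwards [hG] with x hx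
    calc dloss v x (v - u) ≤ ‖dloss v x‖ * ‖v - u‖ :=
          (le_abs_self _).trans ((dloss v x).le_opNorm _)
      _ ≤ G * ‖v - u‖ := mul_le_mul_of_nonneg_right (hx v hv) (norm_nonneg _)
      _ = 0 := h2
  linarith

end Degenerate

/-- A union bound by covering the whole space, so the good set `S` need not be measurable. -/
theorem one_sub_le_measureReal {Ω ι : Type*} [MeasurableSpace Ω] [Fintype ι] {μ : Measure Ω}
    [IsProbabilityMeasure μ] {S A : Set Ω} {B : ι → Set Ω} {Q : Ω → Prop} {α β : ℝ}
    (hQ : ∀ᵐ ω ∂μ, Q ω) (hA : μ.real A ≤ α) (hB : ∀ i, μ.real (B i) ≤ β)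
    (hS : ∀ ω, Q ω → ω ∉ A → (∀ i, ω ∉ B i) → ω ∈ S) :
    1 - (α + Fintype.card ι * β) ≤ μ.real S := by
  have h1 : (Set.univ : Set Ω) ⊆ S ∪ ({ω | ¬ Q ω} ∪ (A ∪ ⋃ i, B i)) := by
    intro ω _
    by_contra h
    simp only [Set.mem_union, Set.mem_ofPred_eq, Set.mem_iUnion, not_or, not_not,
      not_exists] at h
    exact h.1 (hS ω h.2.1 h.2.2.1 h.2.2.2)
  have h2 := measureReal_mono (μ := μ) h1
  have h3 := measureReal_union_le (μ := μ) S ({ω | ¬ Q ω} ∪ (A ∪ ⋃ i, B i))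
  have h4 := measureReal_union_le (μ := μ) {ω | ¬ Q ω} (A ∪ ⋃ i, B i)
  have h5 := measureReal_union_le (μ := μ) A (⋃ i, B i)
  have h6 : μ.real (⋃ i, B i) ≤ Fintype.card ι * β := by
    refine (measureReal_iUnion_fintype_le B).trans ?_
    refine (Finset.sum_le_sum fun i _ => hB i).trans ?_
    simp
  have h7 : μ.real {ω | ¬ Q ω} = 0 := by
    rw [measureReal_def, ae_iff.1 hQ, ENNReal.toReal_zero]
  rw [probReal_univ] at h2
  linarith

end WeightedGDRO

end

/-! ### Assembly of the main bound. -/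

theorem theorem5
    {E : Type*} [NormedAddCommGroup E] [NormedSpace ℝ E] [FiniteDimensional ℝ E]
    [MeasurableSpace E] [BorelSpace E] {Z : Type*} [MeasurableSpace Z]
    {Ω : Type*} [MeasurableSpace Ω] (μ : Measure Ω) [IsProbabilityMeasure μ]
    {m : ℕ} [NeZero m]
    -- the domain and its distance-generating function
    (W : Set E) (hW_nonempty : W.Nonempty) (hW_closed : IsClosed W) (hW_convex : Convex ℝ W)
    (ν : E → ℝ) (dν : E → E →L[ℝ] ℝ) (hν : WeightedGDRO.IsDistanceGenerating W ν dν)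
    (D : ℝ) (hD : ∀ u ∈ W, ∀ v ∈ W, ν u - ν v ≤ D ^ 2)
    -- the distributions, the loss and its gradient in the first variable
    (P : Fin m → Measure Z) [∀ i, IsProbabilityMeasure (P i)]
    (loss : E → Z → ℝ) (dloss : E → Z → E →L[ℝ] ℝ)
    (hloss_meas : Measurable fun x : W × Z => loss (x.1 : E) x.2)
    (hdloss_meas : Measurable fun x : W × Z => dloss (x.1 : E) x.2)
    (hgrad : ∀ i, ∀ᵐ z ∂P i, ∀ w ∈ W,
      HasFDerivWithinAt (fun u => loss u z) (dloss w z) W w)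
    (hrisk_convex : ∀ i, ConvexOn ℝ W (WeightedGDRO.risk loss (P i)))
    (hloss_bound : ∀ i, ∀ᵐ z ∂P i, ∀ w ∈ W, 0 ≤ loss w z ∧ loss w z ≤ 1)
    (G : ℝ) (hgrad_bound : ∀ i, ∀ᵐ z ∂P i, ∀ w ∈ W, ‖dloss w z‖ ≤ G)
    -- the budgets
    (n : Fin m → ℕ) (hn_pos : ∀ i, 0 < n i) (hn_anti : Antitone n)
    -- the random draws and the iterates of the algorithm in `n 0` rounds
    (b : Fin (n 0) → Fin m → Ω → Bool) (z : Fin (n 0) → Fin m → Ω → Z)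
    (hsampling : WeightedGDRO.IsSampling μ P (WeightedGDRO.scale n) (n 0) b z)
    (w : ℕ → Ω → E) (q : ℕ → Ω → Fin m → ℝ)
    (hrun : ∀ ω, WeightedGDRO.IsSMDRun W ν dν loss dloss
      (WeightedGDRO.stepW D G m (n 0)) (WeightedGDRO.stepQ D G m (n 0)) (n 0)
      (fun t i => b t i ω) (fun t i => z t i ω) (fun t => w t ω) (fun t => q t ω))
    (δ : ℝ) (hδ_pos : 0 < δ) (hδ_lt : δ < 1) :
    1 - δ ≤ μ.real {ω | ∀ i : Fin m,
        WeightedGDRO.risk loss (P i) (WeightedGDRO.average (fun t => w t ω) (n 0))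
            - (n 0 : ℝ) / (n i : ℝ) * WeightedGDRO.optimalValue W loss P n
          ≤ 1 / WeightedGDRO.scale n i * (8 + 2 * Real.log (2 / δ))
              * √(10 * (D ^ 2 * G ^ 2 + Real.log m) / (n 0 : ℝ))} ∧
    ∀ i : Fin m,
      1 / WeightedGDRO.scale n i * (8 + 2 * Real.log (2 / δ))
          * √(10 * (D ^ 2 * G ^ 2 + Real.log m) / (n 0 : ℝ))
        = (8 + 2 * Real.log (2 / δ))
          * (√(10 * (D ^ 2 * G ^ 2 + Real.log m) * (n 0 : ℝ)) / (n i : ℝ)) := by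
  have hT : 0 < n 0 := hn_pos 0
  have hTr : (0 : ℝ) < n 0 := Nat.cast_pos.2 hT
  have hTne : NeZero (n 0) := ⟨hT.ne'⟩
  have hm1 : 1 ≤ m := Nat.pos_of_ne_zero (NeZero.ne m)
  have hnr : ∀ i, (0 : ℝ) < n i := fun i => Nat.cast_pos.2 (hn_pos i)
  have hp : ∀ i, 0 < WeightedGDRO.scale n i := WeightedGDRO.scale_pos hn_pos
  have hG0 : 0 ≤ G := by
    obtain ⟨x, hx⟩ := (hgrad_bound 0).exists
    exact (norm_nonneg _).trans (hx _ hW_nonempty.some_mem)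
  have hlog : 0 ≤ Real.log m := Real.log_nonneg (by exact_mod_cast hm1)
  have hL : 0 < Real.log (2 / δ) := Real.log_pos (by rw [lt_div_iff₀ hδ_pos]; linarith)
  set L := Real.log (2 / δ) with hLdef
  set K := D ^ 2 * G ^ 2 + Real.log m with hKdef
  have hK0 : 0 ≤ K := by positivity
  have hwW : ∀ ω, ∀ t < n 0, w t ω ∈ W := fun ω t ht => (hrun ω).mem ht.le
  constructor
  swap
  · intro i
    have h1 : √(10 * K * (n 0 : ℝ)) = n 0 * √(10 * K / n 0) := by
      rw [← Real.sqrt_sq hTr.le, ← Real.sqrt_mul (sq_nonneg _), Real.sqrt_sq hTr.le]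
      congr 1
      field_simp
    have h2 := (hnr i).ne'
    rw [h1, WeightedGDRO.scale]
    field_simp
  have hunscale : ∀ (i : Fin m) (R s : ℝ),
      WeightedGDRO.scale n i * R - s ≤ (8 + 2 * L) * √(10 * K / n 0) →
      R - (n 0 : ℝ) / n i * s
        ≤ 1 / WeightedGDRO.scale n i * (8 + 2 * L) * √(10 * K / n 0) := by
    intro i R s h
    have h1 : (n 0 : ℝ) / n i = 1 / WeightedGDRO.scale n i := by
      rw [WeightedGDRO.scale, one_div_div]
    have h2 : R - 1 / WeightedGDRO.scale n i * s
        = 1 / WeightedGDRO.scale n i * (WeightedGDRO.scale n i * R - s) := by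
      have := (hp i).ne'
      field_simp
    rw [h1, h2, mul_assoc]
    exact mul_le_mul_of_nonneg_left h (one_div_pos.2 (hp i)).le
  have hW_ne : Nonempty W := hW_nonempty.to_subtype
  -- If K = 0 the asserted bound is zero, but all risks are constant on `W`, so it holds surely.
  rcases hK0.eq_or_lt with hK | hK
  · have hDG : D ^ 2 * G ^ 2 = 0 := by nlinarith [mul_nonneg (sq_nonneg D) (sq_nonneg G)]
    have huniv : {ω | ∀ i : Fin m,
        WeightedGDRO.risk loss (P i) (WeightedGDRO.average (fun t => w t ω) (n 0))
            - (n 0 : ℝ) / (n i : ℝ) * WeightedGDRO.optimalValue W loss P n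
          ≤ 1 / WeightedGDRO.scale n i * (8 + 2 * L) * √(10 * K / (n 0 : ℝ))} = Set.univ := by
      refine Set.eq_univ_of_forall fun ω i => hunscale i _ _ ?_
      rw [← hK, mul_zero, zero_div, Real.sqrt_zero, mul_zero, sub_nonpos]
      refine le_ciInf fun u => ?_
      refine le_trans ?_ (WeightedGDRO.weightedObjective_le_iSup hloss_bound hn_pos u.2
        (single_mem_stdSimplex ℝ i))
      rw [WeightedGDRO.weightedObjective_single]
      refine mul_le_mul_of_nonneg_left ?_ (hp i).le
      refine le_of_mul_le_mul_left ?_ hTr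
      refine (WeightedGDRO.average_risk_le (hrisk_convex i) hT (hwW ω)).trans ?_
      refine (Finset.sum_le_sum fun t ht => WeightedGDRO.risk_le_of_mul_eq_zero
        hν.strongConvexOn hD hloss_meas (hgrad i) (hrisk_convex i) (hloss_bound i)
        (hgrad_bound i) hDG (hwW ω t (Finset.mem_range.1 ht)) u.2).trans ?_
      simp
    rw [huniv, probReal_univ]
    linarith
  set S := √(n 0 * K) with hSdef
  have hS : 0 < S := Real.sqrt_pos.2 (mul_pos hTr hK)
  have hε : 0 < S / n 0 := div_pos hS hTr
  -- Attainment of the minimum is not needed: a deterministic near-minimizer costs only one extra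
  -- `S` over all rounds.
  obtain ⟨u, hu⟩ := exists_lt_of_ciInf_lt
    (lt_add_of_pos_right (WeightedGDRO.optimalValue W loss P n) hε)
  have hgood : ∀ᵐ ω ∂μ, ∀ t i, b t i ω = true →
      (∀ w ∈ W, 0 ≤ loss w (z t i ω) ∧ loss w (z t i ω) ≤ 1) ∧
        ∀ w ∈ W, ‖dloss w (z t i ω)‖ ≤ G := by
    rw [ae_all_iff]; intro t
    rw [ae_all_iff]; intro i
    exact hsampling.ae_of_ae ((hloss_bound i).and (hgrad_bound i)) t
  have hA := WeightedGDRO.gradTerm_tail hν hD hloss_meas hdloss_meas hsampling hp hrun hG0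
    hgrad_bound u.2 hK (by linarith) L
  have hB := WeightedGDRO.lossTerm_tail hν hloss_meas hdloss_meas hsampling hp hrun
    hloss_bound hK (by linarith [mul_nonneg (sq_nonneg D) (sq_nonneg G)]) hL
  have hexp : Real.exp (-L) = δ / 2 := by
    rw [Real.exp_neg, hLdef, Real.exp_log (by positivity), inv_div]
  have hsum : Real.exp (-L) + Fintype.card (Fin m) * Real.exp (-(Real.log m + L)) = δ := by
    have hm : (0 : ℝ) < m := by exact_mod_cast hm1
    rw [neg_add, Real.exp_add, hexp, Real.exp_neg, Real.exp_log hm, Fintype.card_fin]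
    field_simp
    norm_num
  rw [← hsum]
  refine WeightedGDRO.one_sub_le_measureReal hgood hA hB fun ω hω hωA hωB i => hunscale i _ _ ?_
  have hgap := WeightedGDRO.weightedGap_le_noise (α := √(8 / (5 * n 0 * K))) hν
    (Real.sqrt_pos.2 (by positivity)) hD hloss_meas (fun i => (hp i).le) hgrad hrisk_convex
    hloss_bound hG0 hgrad_bound (hrun ω) (fun t i h => (hω t i h).1) (fun t i h => (hω t i h).2)
    u.2 i
  have hrate := WeightedGDRO.regret_rate_le hTr hK
  rw [Set.mem_ofPred_eq, not_le] at hωA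
  have hωBi := hωB i
  rw [Set.mem_ofPred_eq, not_le] at hωBi
  have havg := WeightedGDRO.average_risk_le (hrisk_convex i) hT (hwW ω)
  have hopt : ∀ t ∈ Finset.range (n 0), ∑ j, q t ω j * WeightedGDRO.scale n j
      * WeightedGDRO.risk loss (P j) u ≤ WeightedGDRO.optimalValue W loss P n + S / n 0 :=
    fun t ht => (WeightedGDRO.weightedObjective_le_iSup hloss_bound hn_pos u.2
      ((hrun ω).q_mem (Finset.mem_range.1 ht).le).1).trans hu.le
  have hopt' := Finset.sum_le_sum hopt
  rw [Finset.sum_const, Finset.card_range, nsmul_eq_mul, mul_add, mul_div_cancel₀ _ hTr.ne'] at hopt'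
  rw [Finset.sum_sub_distrib, ← Finset.mul_sum, ← hKdef] at hgap
  have havg' := mul_le_mul_of_nonneg_left havg (hp i).le
  have hsqrt : (n 0 : ℝ) * √(10 * K / n 0) = √10 * S := by
    rw [hSdef, ← Real.sqrt_mul (by norm_num), ← Real.sqrt_sq hTr.le, ← Real.sqrt_mul (sq_nonneg _),
      Real.sqrt_sq hTr.le]
    congr 1
    field_simp
  have h10 : 3 ≤ √(10 : ℝ) := Real.le_sqrt_of_sq_le (by norm_num)
  refine le_of_mul_le_mul_left ?_ hTr
  -- Here 25/3 = 2 + 3 + 7/3 + 1 and 7/2 = 2 + 3/2 collect gradient noise, loss noise, regret and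
  -- the slack of `u`.
  have hfinal : (25 / 3 + 7 / 2 * L) * S ≤ (8 + 2 * L) * (√10 * S) := by
    have : (8 + 2 * L) * (3 * S) ≤ (8 + 2 * L) * (√10 * S) := by gcongr
    nlinarith [mul_pos hL hS]
  rw [mul_left_comm, hsqrt]
  nlinarith
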